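/- **Setting.** Let $Act=H\cup L\cup\{\tau\}$ be a finite set of actions ($H$ high-level, $L$ low-level, $\tau$ silent, pairwise disjoint), and $\mathcal C$ a finite set of constants. CFM terms are given by $$s::=\mathbf 0\mid\mu.q\mid s+s\ \text{(guarded)},\qquad q::=s\mid C\ \text{(sequential)},\qquad p::=q\mid p\,|\,p\ \text{(parallel)},$$ where a constant $C$ may have a defining equation $C\doteq s$ with $s$ guarded. A *process* is a term such that all constants used in it (directly, or through the bodies of constants used in it) have defining equations. Open terms may also contain variables $x$, which stand in the places of constants and can be replaced by sequential terms. The transitions $p\xrightarrow{\mu}p'$ are the usual ones: $\mu.p\xrightarrow{\mu}p$; a sum moves as either summand; $C$ moves as its body; in $p\,|\,q$ one component moves and the other stays. Reachability is w.r.t. all transitions. **Net semantics.** Places are the sequential processes other than $\mathbf 0$. Markings are multisets of places, $\theta$ is the empty marking; $dec(\mathbf 0)=\theta$, $dec(p\,|\,q)=dec(p)\oplus dec(q)$, and $dec(p)=\{p\}$ for every other $p$. For a set $I$ of constants, the net $[\![p]\!]_I$ with places $S$, transitions $T$ and initial marking $dec(p)$ is: empty for $p=\mathbf 0$; for $\mu.p$,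 the net $[\![p]\!]_I$ plus the place $\mu.p$ and the transition $(\mu.p,\mu,dec(p))$; for $p_1+p_2$, the place $p_1+p_2$, the transitions $(p_1+p_2,\mu,m)$ with $(p_i,\mu,m)\in T_i$ for some $i$, and both nets $[\![p_i]\!]_I=(S_i,T_i)$, where from the $i$-th one the place $p_i$ and the transitions leaving it are removed if no transition in $T_i$ reaches $p_i$; for $p_1\,|\,p_2$, the union of the two nets; for $C\in I$, the single place $C$ without transitions; for $C\notin I$ with $C\doteq p$, the place $C$, the transitions $(C,\mu,m)$ with $(p,\mu,m)$ in $[\![p]\!]_{I\cup\{C\}}$, and the net $[\![p]\!]_{I\cup\{C\}}$, with $p$ and the transitions leaving it removed if no transition of that net reaches $p$. The net of $p$ is $[\![p]\!]_\emptyset$, and the net of $p\setminus H$ is obtained from it by deleting the transitions with labels in $H$ (each place $s$ being renamed $s\setminus H$). **Equivalence.** On the places of a net, let $s\stackrel{\epsilon}{\Rightarrow}m$ denote the reflexive-transitive closure of $\tau$-transitions, where $m$ is a place or $\theta$. A relation $R$ on places is a *branching bisimulation* if, whenever $(s_1,s_2)\in R$ and $s_1\xrightarrow{\ell}m_1$,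 either $\ell=\tau$ and $s_2\stackrel{\epsilon}{\Rightarrow}m_2$ with $(s_1,m_2),(m_1,m_2)\in R$ for some $m_2$, or $s_2\stackrel{\epsilon}{\Rightarrow}s\xrightarrow{\ell}m_2$ with $(s_1,s)\in R$ and ($m_1=\theta=m_2$ or $(m_1,m_2)\in R$) for some $s,m_2$; and symmetrically for the moves of $s_2$. Let $\approx$ be the union of all branching bisimulations. Places satisfy $s_1\approx_c s_2$ if every $s_1\xrightarrow{\ell}m_1$ is matched by some $s_2\xrightarrow{\ell}m_2$ with $m_1=\theta=m_2$ or $m_1\approx m_2$, and vice versa. *Rooted branching team equivalence* $\approx_c^\oplus$ on markings is the additive closure of $\approx_c$ (a pairing of the tokens of the two markings by $\approx_c$). For $p\setminus H\approx_c^\oplus q\setminus H$ one compares $dec(p)\setminus H$ and $dec(q)\setminus H$ in the union of the nets of $p\setminus H$ and $q\setminus H$. A process $p$ *satisfies DNI* (rooted variant) if $p'\setminus H\approx_c^\oplus p''\setminus H$ whenever $p'$ is reachable from $p$ and $p'\xrightarrow{h}p''$ with $h\in H$. **Equational theory.** $E\vdash p=q$ denotes derivability by reflexivity, symmetry, transitivity,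 substitutivity, instantiation, and the recursion rule "from $p=q$, $A\doteq p\{A/x\}$, $B\doteq q\{B/x\}$ infer $A=B$", from the following laws, all instances having to be legal terms: - A1: $x+(y+z)=(x+y)+z$; A2: $x+y=y+x$; A3: $x+\mathbf 0=x$ if $x\ne\mathbf 0$; A4: $x+x=x$ if $x\neq\mathbf 0$; - B: $\mu.(\tau.(x+y)+x)=\mu.(x+y)$; - R1: $C=\mathbf 0+\mathbf 0$ if $C\doteq\mathbf 0$; R2: $C=p$ if $C\doteq p$ and $p\ne\mathbf 0$; - R3: $C=q$ if $C\doteq p\{C/x\}$, $p\neq\mathbf 0$, there is no nonempty sequence of $\tau$-transitions from $C$ to $C$, and $q=p\{q/x\}$; - U1: $C=D$ if $C\doteq(\tau.x+p)\{C/x\}$ and $D\doteq(\tau.(p+\mathbf 0)+p)\{D/x\}$; - U2: $C=D$ if $C\doteq(\tau.(\tau.x+p)+r)\{C/x\}$ and $D\doteq(\tau.(p+r)+r)\{D/x\}$; - U3: $C=D$ if $C\doteq(\tau.(\tau.q+p)+r)\{C/x\}$, $D\doteq(\tau.(q+p)+r)\{D/x\}$, with $q$ guarded and $x$ having an occurrence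 in $q$ under no prefix other than $\tau$-prefixes; - U4: $C=D$ if $C\doteq(\tau.(\tau.x+p)+\tau.(\tau.x+q)+r)\{C/x\}$ and $D\doteq(\tau.(\tau.x+p+q)+r)\{D/x\}$; - P1: $x|(y|z)=(x|y)|z$; P2: $x|y=y|x$; P3: $x|\mathbf 0=x$. $\{A1\text{-}A4\}\vdash p=q$ is derivability by the same rules from A1-A4 only. **Typing.** Let $r(\mathbf 0)=\mathbf 0$, $r(h.p)=\mathbf 0+\mathbf 0$ for $h\in H$, $r(\mu.p)=\mu.r(p)$ for $\mu\in L\cup\{\tau\}$, $r(p+q)=r(p)+r(q)$, $r(p\,|\,q)=r(p)\,|\,r(q)$, and $r(C)=C'$, where $C'$ is a constant with $C'\doteq r(p)$ if $C\doteq p$. Let $In(p)$ be the set of initial actions: $In(\mathbf 0)=\emptyset$, $In(\mu.p)=\{\mu\}$, $In(p+q)=In(p\,|\,q)=In(p)\cup In(q)$, $In(C)=In(p)$ if $C\doteq p$. The judgements $(p,I):dni$, with $I$ a set of constants, are generated by the following rules, in which all terms have to be legal and $h\in H$: 1. $(\mathbf 0,I):dni$; 2. $(p+q,I):dni$ if $(p,I):dni$,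 $(q,I):dni$ and $In(p+q)\subseteq L\cup\{\tau\}$; 3. $(p\,|\,q,I):dni$ if $(p,I):dni$ and $(q,I):dni$; 4. $(h.p+q,I):dni$ if $(p,I):dni$, $p\ne\mathbf 0$, $(q,I):dni$ and $E\vdash r(p)=r(q)$; 5. $(\mu.p,I):dni$ if $(p,I):dni$ and $\mu\in L\cup\{\tau\}$; 6. $(h.p,I):dni$ if $E\vdash p=\mathbf 0+\mathbf 0$; 7. $(h.p,I):dni$ if $\emptyset\ne In(p)\subseteq H$ and $(p,I):dni$; 8. $(C,I):dni$ if $C\in I$; 9. $(C,I):dni$ if $C\notin I$, $C\doteq p$, $\{A1\text{-}A4\}\vdash p=p'$ and $(p',I\cup\{C\}):dni$. **Proposition.** For each CFM process $p$, if $(p,\emptyset):dni$ is derivable, then $p$ satisfies DNI. -/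

import Mathlib

namespace CFM

/-- Actions: high-level actions, low-level actions, and the silent action `τ`. -/
inductive Act (H L : Type*) where
  | high (h : H)
  | low (l : L)
  | tau

/-- The action belongs to `H`. -/
def Act.IsHigh {H L : Type*} : Act H L → Prop
  | .high _ => True
  | _ => False

/-- Process constants. Every constant `base k` comes with a primed copy `prime k`, the constant
denoted by `C'` in the defining equation `r(C) = C'` of the restriction function. -/
inductive Const (K : Type*) where
  | base (k : K)
  | prime (k : K)

instance {K : Type*} [Finite K] : Finite (Const K) :=
  Finite.of_injective
    (fun c : Const K => (match c with | .base k => Sum.inl k | .prime k => Sum.inr k : K ⊕ K))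
    (by intro a b h; cases a <;> cases b <;> simp_all)

/-- Raw open terms; the three syntactic categories are singled out by `WF`. -/
inductive Tm (H L K : Type*) where
  | nil
  | pre (μ : Act H L) (p : Tm H L K)
  | sum (p q : Tm H L K)
  | con (C : Const K)
  | par (p q : Tm H L K)
  | var (x : ℕ)

/-- The syntactic categories: guarded, sequential and parallel terms. -/
inductive Cat where
  | grd
  | seq
  | par

/-- `WF c p`: the term `p` is generated by the grammar in category `c`. A variable is a
placeholder for a constant and hence lives in the category of sequential terms. -/
inductive WF {H L K : Type*} : Cat → Tm H L K → Prop
  | nil : WF .grd .nil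
  | pre {μ : Act H L} {q : Tm H L K} : WF .seq q → WF .grd (.pre μ q)
  | sum {s s' : Tm H L K} : WF .grd s → WF .grd s' → WF .grd (.sum s s')
  | ofGrd {s : Tm H L K} : WF .grd s → WF .seq s
  | con (C : Const K) : WF .seq (.con C)
  | var (x : ℕ) : WF .seq (.var x)
  | ofSeq {q : Tm H L K} : WF .seq q → WF .par q
  | par {p p' : Tm H L K} : WF .par p → WF .par p' → WF .par (.par p p')

section Terms

variable {H L K : Type*}

/-- No variable occurs in the term. -/
def Tm.IsClosed : Tm H L K → Prop
  | .nil => True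
  | .pre _ p => p.IsClosed
  | .sum p q => p.IsClosed ∧ q.IsClosed
  | .con _ => True
  | .par p q => p.IsClosed ∧ q.IsClosed
  | .var _ => False

/-- `p.subst x t` is `p{t/x}`. -/
def Tm.subst : Tm H L K → ℕ → Tm H L K → Tm H L K
  | .nil, _, _ => .nil
  | .pre μ p, x, t => .pre μ (p.subst x t)
  | .sum p q, x, t => .sum (p.subst x t) (q.subst x t)
  | .con C, _, _ => .con C
  | .par p q, x, t => .par (p.subst x t) (q.subst x t)
  | .var y, x, t => if y = x then t else .var y

/-- `x` is unguarded in the term: it has an occurrence that lies in the scope of no prefix other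
than `τ`-prefixes. -/
def Tm.Unguarded (x : ℕ) : Tm H L K → Prop
  | .nil => False
  | .pre .tau p => p.Unguarded x
  | .pre _ _ => False
  | .sum p q => p.Unguarded x ∨ q.Unguarded x
  | .con _ => False
  | .par p q => p.Unguarded x ∨ q.Unguarded x
  | .var y => y = x

/-- The constants occurring syntactically in the term. -/
def Tm.occ : Tm H L K → Set (Const K)
  | .nil => ∅
  | .pre _ p => p.occ
  | .sum p q => p.occ ∪ q.occ
  | .con C => {C}
  | .par p q => p.occ ∪ q.occ
  | .var _ => ∅

/-- The constant `C'` with `r(C) = C'`. The body of a primed constant contains no high-level action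
and only primed constants, so that it is fixed by `r`; a primed constant serves as its own copy. -/
def Const.restr : Const K → Const K
  | .base k => .prime k
  | .prime k => .prime k

/-- The restriction function `r`. -/
def Tm.restr : Tm H L K → Tm H L K
  | .nil => .nil
  | .pre (.high _) _ => .sum .nil .nil
  | .pre (.low l) p => .pre (.low l) p.restr
  | .pre .tau p => .pre .tau p.restr
  | .sum p q => .sum p.restr q.restr
  | .con C => .con C.restr
  | .par p q => .par p.restr q.restr
  | .var x => .var x

end Terms

/-- An assignment of defining equations to (some of) the constants. Bodies are closed guarded terms;
they may mention every constant, primed ones included. -/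
structure Env (H L K : Type*) where
  eqn : K → Option (Tm H L K)
  guarded : ∀ k s, eqn k = some s → WF .grd s
  closed : ∀ k s, eqn k = some s → s.IsClosed

section Calculus

variable {H L K : Type*} (D : Env H L K)

/-- `D.body C = some p` is the defining equation `C ≐ p`; if `C ≐ p` then `C' ≐ r(p)`. -/
def Env.body : Const K → Option (Tm H L K)
  | .base k => D.eqn k
  | .prime k => (D.eqn k).map Tm.restr

/-- `Uses D p C`: the constant `C` belongs to `const(p)`. -/
inductive Uses : Tm H L K → Const K → Prop
  | occ {p : Tm H L K} {C : Const K} : C ∈ p.occ → Uses p C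
  | unfold {p s : Tm H L K} {C C' : Const K} :
      Uses p C → D.body C = some s → C' ∈ s.occ → Uses p C'

/-- CFM processes: closed terms of the grammar all of whose constants have a definition. -/
structure IsCFM (p : Tm H L K) : Prop where
  wf : WF .par p
  closed : p.IsClosed
  defined : ∀ C, Uses D p C → ∃ s, D.body C = some s

/-- The structural operational semantics. -/
inductive Step : Tm H L K → Act H L → Tm H L K → Prop
  | pre {μ : Act H L} {p : Tm H L K} : Step (.pre μ p) μ p
  | con {μ : Act H L} {C : Const K} {p p' : Tm H L K} :
      D.body C = some p → Step p μ p' → Step (.con C) μ p'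
  | sumL {μ : Act H L} {p q p' : Tm H L K} : Step p μ p' → Step (.sum p q) μ p'
  | sumR {μ : Act H L} {p q q' : Tm H L K} : Step q μ q' → Step (.sum p q) μ q'
  | parL {μ : Act H L} {p q p' : Tm H L K} : Step p μ p' → Step (.par p q) μ (.par p' q)
  | parR {μ : Act H L} {p q q' : Tm H L K} : Step q μ q' → Step (.par p q) μ (.par p q')

/-- `p'` is reachable from `p`. -/
def Reachable (p p' : Tm H L K) : Prop :=
  Relation.ReflTransGen (fun a b => ∃ μ, Step D a μ b) p p'

/-- Membership of an action in the set `In(p)` of initial actions. -/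
inductive Init : Tm H L K → Act H L → Prop
  | pre {μ : Act H L} {p : Tm H L K} : Init (.pre μ p) μ
  | sumL {μ : Act H L} {p q : Tm H L K} : Init p μ → Init (.sum p q) μ
  | sumR {μ : Act H L} {p q : Tm H L K} : Init q μ → Init (.sum p q) μ
  | parL {μ : Act H L} {p q : Tm H L K} : Init p μ → Init (.par p q) μ
  | parR {μ : Act H L} {p q : Tm H L K} : Init q μ → Init (.par p q) μ
  | con {μ : Act H L} {C : Const K} {p : Tm H L K} :
      D.body C = some p → Init p μ → Init (.con C) μ

/-- The set `In(p)`. -/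
def initials (p : Tm H L K) : Set (Act H L) := {μ | Init D p μ}

end Calculus

/-- A net whose transitions have a single place as pre-set and a single place or the empty marking
`θ` (written `none`) as post-set. -/
structure Net (P A : Type*) where
  places : Set P
  trans : Set (P × A × Option P)

section Nets

variable {P H L : Type*}

/-- The union of two nets. -/
def Net.union (N M : Net P (Act H L)) : Net P (Act H L) :=
  ⟨N.places ∪ M.places, N.trans ∪ M.trans⟩

/-- The low-observable subnet: high-labelled transitions are pruned. The decoration `s ↦ s \ H` of the
places is an injective renaming and is left implicit. -/
def Net.prune (N : Net P (Act H L)) : Net P (Act H L) :=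
  ⟨N.places, {t | t ∈ N.trans ∧ ¬ t.2.1.IsHigh}⟩

open Classical in
/-- Removes the place `s` and the transitions leaving it, unless some transition of the net
reaches `s`. -/
noncomputable def Net.keep (N : Net P (Act H L)) (s : P) : Net P (Act H L) :=
  if ∃ t ∈ N.trans, t.2.2 = some s then N
  else ⟨N.places \ {s}, {t | t ∈ N.trans ∧ t.1 ≠ s}⟩

/-- The reflexive and transitive closure of the silent transition relation. -/
inductive Net.Silent (N : Net P (Act H L)) : P → Option P → Prop
  | refl (s : P) : Net.Silent N s (some s)
  | step {s s' : P} {m : Option P} :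
      Net.Silent N s (some s') → (s', Act.tau, m) ∈ N.trans → Net.Silent N s m

/-- The two post-sets are both empty, or they are places related by `R`. -/
def PostRel (R : P → P → Prop) (m₁ m₂ : Option P) : Prop :=
  (m₁ = none ∧ m₂ = none) ∨ ∃ a b, m₁ = some a ∧ m₂ = some b ∧ R a b

/-- Every move of `s₁` is matched by `s₂`, in the sense of branching bisimulation. -/
def Net.BranchMatch (N : Net P (Act H L)) (R : P → P → Prop) (s₁ s₂ : P) : Prop :=
  ∀ (ℓ : Act H L) (m₁ : Option P), (s₁, ℓ, m₁) ∈ N.trans →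
    (ℓ = Act.tau ∧ ∃ a b, m₁ = some a ∧ N.Silent s₂ (some b) ∧ R s₁ b ∧ R a b) ∨
    (∃ s m₂, N.Silent s₂ (some s) ∧ (s, ℓ, m₂) ∈ N.trans ∧ R s₁ s ∧ PostRel R m₁ m₂)

/-- Branching bisimulations on the places of a net. -/
def Net.IsBranchingBisim (N : Net P (Act H L)) (R : P → P → Prop) : Prop :=
  ∀ s₁ s₂, R s₁ s₂ → s₁ ∈ N.places ∧ s₂ ∈ N.places ∧
    N.BranchMatch R s₁ s₂ ∧ N.BranchMatch (fun a b => R b a) s₂ s₁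

/-- Branching bisimilarity `≈` on places. -/
def Net.BranchingBisimilar (N : Net P (Act H L)) (s₁ s₂ : P) : Prop :=
  ∃ R, N.IsBranchingBisim R ∧ R s₁ s₂

/-- Rooted branching bisimilarity `≈_c` on places. -/
def Net.Rooted (N : Net P (Act H L)) (s₁ s₂ : P) : Prop :=
  s₁ ∈ N.places ∧ s₂ ∈ N.places ∧ ∀ ℓ : Act H L,
    (∀ m₁, (s₁, ℓ, m₁) ∈ N.trans →
      ∃ m₂, (s₂, ℓ, m₂) ∈ N.trans ∧ PostRel N.BranchingBisimilar m₁ m₂) ∧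
    (∀ m₂, (s₂, ℓ, m₂) ∈ N.trans →
      ∃ m₁, (s₁, ℓ, m₁) ∈ N.trans ∧ PostRel N.BranchingBisimilar m₁ m₂)

/-- Rooted branching team equivalence `≈_c^⊕` on markings: `Multiset.Rel` is the additive closure. -/
def Net.RootedTeam (N : Net P (Act H L)) (m₁ m₂ : Multiset P) : Prop :=
  Multiset.Rel N.Rooted m₁ m₂

end Nets

section Semantics

variable {H L K : Type*} (D : Env H L K)

/-- The decomposition function. -/
def dec : Tm H L K → Multiset (Tm H L K)
  | .nil => 0
  | .pre μ p => {.pre μ p}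
  | .sum p q => {.sum p q}
  | .con C => {.con C}
  | .par p q => dec p + dec q
  | .var x => {.var x}

/-- The marking `dec p` of a sequential term `p`, as a post-set of a transition. -/
def post : Tm H L K → Option (Tm H L K)
  | .nil => none
  | p => some p

open Classical in
/-- The places and the transitions of the net `⟦p⟧_I`; its initial marking is `dec p`. -/
noncomputable def net [Finite K] (I : Set (Const K)) : Tm H L K → Net (Tm H L K) (Act H L)
  | .nil => ⟨∅, ∅⟩
  | .var x => ⟨{.var x}, ∅⟩
  | .pre μ p =>
      ⟨{.pre μ p} ∪ (net I p).places, {(.pre μ p, μ, post p)} ∪ (net I p).trans⟩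
  | .sum p q =>
      ⟨{.sum p q} ∪ ((net I p).keep p).places ∪ ((net I q).keep q).places,
        {t | t.1 = .sum p q ∧ ((p, t.2) ∈ (net I p).trans ∨ (q, t.2) ∈ (net I q).trans)} ∪
          ((net I p).keep p).trans ∪ ((net I q).keep q).trans⟩
  | .par p q => (net I p).union (net I q)
  | .con C =>
      if _h : C ∈ I then ⟨{.con C}, ∅⟩
      else match D.body C with
        | none => ⟨{.con C}, ∅⟩
        | some s =>
            ⟨{.con C} ∪ ((net (insert C I) s).keep s).places,
              {t | t.1 = .con C ∧ (s, t.2) ∈ (net (insert C I) s).trans} ∪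
                ((net (insert C I) s).keep s).trans⟩
termination_by p => (Iᶜ.ncard, sizeOf p)
decreasing_by
  all_goals first
    | (apply Prod.Lex.right; simp; omega)
    | (apply Prod.Lex.right; simp)
    | (apply Prod.Lex.left
       apply Set.ncard_lt_ncard _ (Set.toFinite _)
       refine ⟨fun c hc hI => hc (Set.mem_insert_of_mem _ hI), fun hsub => ?_⟩
       exact hsub (show C ∈ Iᶜ from _h) (Set.mem_insert C I))

/-- `p \ H ≈_c^⊕ q \ H`: the markings of `p` and `q` are rooted branching team equivalent in the union
of the nets of `p \ H` and `q \ H`. -/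
def LowEquiv [Finite K] (p q : Tm H L K) : Prop :=
  ((net D ∅ p).prune.union (net D ∅ q).prune).RootedTeam (dec p) (dec q)

/-- Distributed non-interference, in the variant based on rooted branching team equivalence. -/
def DNI [Finite K] (p : Tm H L K) : Prop :=
  ∀ (p' p'' : Tm H L K) (h : H),
    Reachable D p p' → Step D p' (.high h) p'' → LowEquiv D p' p''

end Semantics

/-- Names of the laws of the equational theory. -/
inductive Law where
  | A1 | A2 | A3 | A4 | B | R1 | R2 | R3 | U1 | U2 | U3 | U4 | P1 | P2 | P3

/-- The set `E` of all laws. -/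
def lawsE : Set Law := Set.univ

/-- The laws `A1`-`A4` for choice. -/
def lawsA : Set Law := {.A1, .A2, .A3, .A4}

section Deduction

variable {H L K : Type*} (D : Env H L K)

/-- `og(p)` for the body `p` of the constant `C`: there is no nonempty silent computation from `C`
to `C`. -/
def ObsGuarded (C : Const K) : Prop :=
  ¬ Relation.TransGen (fun a b => Step D a .tau b) (.con C) (.con C)

/-- `Deriv D 𝓔 p q`: the equation `p = q` between (open) terms is derivable by equational deduction,
including the recursion congruence rule, from the laws in `𝓔`. -/
inductive Deriv (𝓔 : Set Law) : Tm H L K → Tm H L K → Prop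
  | refl {p : Tm H L K} : WF .par p → Deriv 𝓔 p p
  | symm {p q : Tm H L K} : Deriv 𝓔 p q → Deriv 𝓔 q p
  | trans {p q r : Tm H L K} : Deriv 𝓔 p q → Deriv 𝓔 q r → Deriv 𝓔 p r
  | pre {μ : Act H L} {p q : Tm H L K} : WF .seq p → WF .seq q →
      Deriv 𝓔 p q → Deriv 𝓔 (.pre μ p) (.pre μ q)
  | sum {p q p' q' : Tm H L K} : WF .grd p → WF .grd q → WF .grd p' → WF .grd q' →
      Deriv 𝓔 p p' → Deriv 𝓔 q q' → Deriv 𝓔 (.sum p q) (.sum p' q')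
  | par {p q p' q' : Tm H L K} :
      Deriv 𝓔 p p' → Deriv 𝓔 q q' → Deriv 𝓔 (.par p q) (.par p' q')
  | inst {p q t : Tm H L K} (x : ℕ) : WF .seq t →
      Deriv 𝓔 p q → Deriv 𝓔 (p.subst x t) (q.subst x t)
  | recCong {p q : Tm H L K} {A B : Const K} (x : ℕ) : Deriv 𝓔 p q →
      D.body A = some (p.subst x (.con A)) → D.body B = some (q.subst x (.con B)) →
      Deriv 𝓔 (.con A) (.con B)
  | A1 {p q r : Tm H L K} : Law.A1 ∈ 𝓔 → WF .grd p → WF .grd q → WF .grd r →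
      Deriv 𝓔 (.sum p (.sum q r)) (.sum (.sum p q) r)
  | A2 {p q : Tm H L K} : Law.A2 ∈ 𝓔 → WF .grd p → WF .grd q →
      Deriv 𝓔 (.sum p q) (.sum q p)
  | A3 {p : Tm H L K} : Law.A3 ∈ 𝓔 → WF .grd p → p ≠ .nil →
      Deriv 𝓔 (.sum p .nil) p
  | A4 {p : Tm H L K} : Law.A4 ∈ 𝓔 → WF .grd p → p ≠ .nil →
      Deriv 𝓔 (.sum p p) p
  | B {μ : Act H L} {p q : Tm H L K} : Law.B ∈ 𝓔 → WF .grd p → WF .grd q →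
      Deriv 𝓔 (.pre μ (.sum (.pre .tau (.sum p q)) p)) (.pre μ (.sum p q))
  | R1 {C : Const K} : Law.R1 ∈ 𝓔 → D.body C = some .nil →
      Deriv 𝓔 (.con C) (.sum .nil .nil)
  | R2 {C : Const K} {p : Tm H L K} : Law.R2 ∈ 𝓔 → D.body C = some p → p ≠ .nil →
      Deriv 𝓔 (.con C) p
  | R3 {C : Const K} {p q : Tm H L K} (x : ℕ) : Law.R3 ∈ 𝓔 →
      D.body C = some (p.subst x (.con C)) → p ≠ .nil → ObsGuarded D C → WF .seq q →
      Deriv 𝓔 q (p.subst x q) → Deriv 𝓔 (.con C) q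
  | U1 {C C' : Const K} {p : Tm H L K} (x : ℕ) : Law.U1 ∈ 𝓔 →
      D.body C = some ((Tm.sum (.pre .tau (.var x)) p).subst x (.con C)) →
      D.body C' = some ((Tm.sum (.pre .tau (.sum p .nil)) p).subst x (.con C')) →
      Deriv 𝓔 (.con C) (.con C')
  | U2 {C C' : Const K} {p r : Tm H L K} (x : ℕ) : Law.U2 ∈ 𝓔 →
      D.body C = some
        ((Tm.sum (.pre .tau (.sum (.pre .tau (.var x)) p)) r).subst x (.con C)) →
      D.body C' = some ((Tm.sum (.pre .tau (.sum p r)) r).subst x (.con C')) →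
      Deriv 𝓔 (.con C) (.con C')
  | U3 {C C' : Const K} {p q r : Tm H L K} (x : ℕ) : Law.U3 ∈ 𝓔 →
      WF .grd q → q.Unguarded x →
      D.body C = some ((Tm.sum (.pre .tau (.sum (.pre .tau q) p)) r).subst x (.con C)) →
      D.body C' = some ((Tm.sum (.pre .tau (.sum q p)) r).subst x (.con C')) →
      Deriv 𝓔 (.con C) (.con C')
  | U4 {C C' : Const K} {p q r : Tm H L K} (x : ℕ) : Law.U4 ∈ 𝓔 →
      D.body C = some
        ((Tm.sum (.sum (.pre .tau (.sum (.pre .tau (.var x)) p))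
          (.pre .tau (.sum (.pre .tau (.var x)) q))) r).subst x (.con C)) →
      D.body C' = some
        ((Tm.sum (.pre .tau (.sum (.sum (.pre .tau (.var x)) p) q)) r).subst x (.con C')) →
      Deriv 𝓔 (.con C) (.con C')
  | P1 {p q r : Tm H L K} : Law.P1 ∈ 𝓔 → WF .par p → WF .par q → WF .par r →
      Deriv 𝓔 (.par p (.par q r)) (.par (.par p q) r)
  | P2 {p q : Tm H L K} : Law.P2 ∈ 𝓔 → WF .par p → WF .par q →
      Deriv 𝓔 (.par p q) (.par q p)
  | P3 {p : Tm H L K} : Law.P3 ∈ 𝓔 → WF .par p →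
      Deriv 𝓔 (.par p .nil) p

/-- The typing system: `Typing D p I` is the judgement `(p, I) : dni`. -/
inductive Typing : Tm H L K → Set (Const K) → Prop
  | nil {I : Set (Const K)} : Typing .nil I
  | sumLow {p q : Tm H L K} {I : Set (Const K)} : WF .grd p → WF .grd q →
      Typing p I → Typing q I → (∀ μ ∈ initials D (.sum p q), ¬ μ.IsHigh) →
      Typing (.sum p q) I
  | par {p q : Tm H L K} {I : Set (Const K)} : WF .par p → WF .par q →
      Typing p I → Typing q I → Typing (.par p q) I
  | sumHigh {h : H} {p q : Tm H L K} {I : Set (Const K)} : WF .seq p → WF .grd q →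
      Typing p I → p ≠ .nil → Typing q I → Deriv D lawsE p.restr q.restr →
      Typing (.sum (.pre (.high h) p) q) I
  | preLow {μ : Act H L} {p : Tm H L K} {I : Set (Const K)} : WF .seq p →
      Typing p I → ¬ μ.IsHigh → Typing (.pre μ p) I
  | preStuck {h : H} {p : Tm H L K} {I : Set (Const K)} : WF .seq p →
      Deriv D lawsE p (.sum .nil .nil) → Typing (.pre (.high h) p) I
  | preHigh {h : H} {p : Tm H L K} {I : Set (Const K)} : WF .seq p →
      (initials D p).Nonempty → (∀ μ ∈ initials D p, μ.IsHigh) →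
      Typing p I → Typing (.pre (.high h) p) I
  | conMem {C : Const K} {I : Set (Const K)} : C ∈ I → Typing (.con C) I
  | conBody {C : Const K} {p p' : Tm H L K} {I : Set (Const K)} : C ∉ I →
      D.body C = some p → Deriv D lawsA p p' → Typing p' (insert C I) →
      Typing (.con C) I

/-- `p : dni`, i.e. `(p, ∅) : dni` is derivable. -/
def Typed (p : Tm H L K) : Prop := Typing D p ∅

end Deduction

end CFM

/-!
The argument has a semantic part, the soundness of the equational theory for rooted branching team
equivalence, and an inductive part on typing derivations.

*Transition systems.* The bisimilarity on the places of a net, `Bisim`, and its rooted version,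
`RBisim`, are studied over an arbitrary transition relation and an arbitrary set of actions that
may be absorbed. With `τ` absorbed this is branching bisimilarity, and with nothing absorbed it is
strong bisimilarity, so that one soundness proof serves for `E` and for `A1`-`A4`. The form of the
definition, which asks only for the end points of a silent computation to be related, makes
simulations closed under composition (`IsSim.comp`). This yields two up-to techniques:
`bisim_of_upto` with slack on the matching side only, and `bisim_of_upto_visible` with slack on
both sides, but only after visible moves.

*Soundness* (`Deriv.sound`). An open equation is read as the equivalence of all sequential
instances. Variables are guarded by prefixes in guarded terms, so a move of `p{t/x}` comes from a
move of `p` (`step_subst_grd`), and the instances `G{A/x}`, `G{B/x}` for all contexts `G` form a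
bisimulation up to the initial moves of `A` and `B`. This gives the recursion rule
(`rbisim_of_body`) and the laws for unguarded recursion (`rbisim_of_contexts`). For `R3`, the
absence of silent cycles means that `p` cannot silently reach `x`; unfolding `x` once in a context
`G` therefore gives a context whose silent moves never depend on what is substituted for `x`
(`eqv_of_unique_solution`).

*Nets.* The net of a process contains exactly the moves of its places (`net_represents`), hence
equivalence can be verified on the operational semantics (`lowEquiv_of_eqv`).

*Typing.* With high-level actions pruned, `p` and `r(p)` are strongly bisimilar (`lowEqv_restr`),
so the premise `E ⊢ r(p) = r(q)` of the rule for `h.p + q` says that the high-level move to `p` is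
not observable. For recursion, `SafeUpto D n p` says that the reachable states of depth less than
`n` are secure; a guarded term typed under assumptions `I` is secure one step deeper than the
constants in `I` (`Typing.safeUpto`). The body of a constant may be rewritten by `A1`-`A4` before
it is typed; these laws preserve strong bisimilarity, hence security (`SafeUpto.of_strong`), and
also guardedness (`Deriv.grd_of_grd`).
-/

namespace CFM

/-! ### Branching bisimilarity on transition systems -/

section Branching

variable {P A : Type*} (T : P → A → Option P → Prop) (sil : A → Prop)

/-- Computations between places along actions that count as silent. -/
def Quiet : P → P → Prop :=
  Relation.ReflTransGen fun a b => ∃ ℓ, sil ℓ ∧ T a ℓ (some b)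

/-- Every move of `s₁` is matched by `s₂` up to `R`, in the sense of branching bisimulation. The
actions that may be absorbed are those in `sil`; if there are none, this is strong matching. -/
def Sim (R : P → P → Prop) (s₁ s₂ : P) : Prop :=
  ∀ ℓ m₁, T s₁ ℓ m₁ →
    (sil ℓ ∧ ∃ a b, m₁ = some a ∧ Quiet T sil s₂ b ∧ R s₁ b ∧ R a b) ∨
    (∃ s m₂, Quiet T sil s₂ s ∧ T s ℓ m₂ ∧ R s₁ s ∧ PostRel R m₁ m₂)

/-- Branching simulations. -/
def IsSim (R : P → P → Prop) : Prop := ∀ s t, R s t → Sim T sil R s t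

/-- Branching bisimilarity: the union of the simulations whose converse is a simulation. -/
def Bisim (s t : P) : Prop := ∃ R, IsSim T sil R ∧ IsSim T sil (flip R) ∧ R s t

/-- Every move of `s` is matched by a single equally labelled move of `t`, up to `R`. -/
def Root (R : P → P → Prop) (s t : P) : Prop :=
  ∀ ℓ m₁, T s ℓ m₁ → ∃ m₂, T t ℓ m₂ ∧ PostRel R m₁ m₂

/-- Rooted branching bisimilarity. -/
def RBisim (s t : P) : Prop := Root T (Bisim T sil) s t ∧ Root T (Bisim T sil) t s

variable {T sil}

theorem PostRel.mono {R R' : P → P → Prop} (h : ∀ a b, R a b → R' a b) {m m' : Option P} :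
    PostRel R m m' → PostRel R' m m' := by
  rintro (h1 | ⟨a, b, h1, h2, h3⟩)
  · exact .inl h1
  · exact .inr ⟨a, b, h1, h2, h _ _ h3⟩

theorem PostRel.flip {R : P → P → Prop} {m m' : Option P} :
    PostRel R m m' → PostRel (flip R) m' m := by
  rintro (⟨h1, h2⟩ | ⟨a, b, h1, h2, h3⟩)
  · exact .inl ⟨h2, h1⟩
  · exact .inr ⟨b, a, h2, h1, h3⟩

theorem PostRel.comp {R R' R'' : P → P → Prop} (h : ∀ a b c, R a b → R' b c → R'' a c)
    {m m' m'' : Option P} (h1 : PostRel R m m') (h2 : PostRel R' m' m'') :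
    PostRel R'' m m'' := by
  rcases h1 with ⟨rfl, rfl⟩ | ⟨a, b, rfl, rfl, h3⟩
  · rcases h2 with ⟨-, rfl⟩ | ⟨a, b, h4, -, -⟩
    · exact .inl ⟨rfl, rfl⟩
    · cases h4
  · rcases h2 with ⟨h4, -⟩ | ⟨b', c, h4, rfl, h5⟩
    · cases h4
    · cases h4
      exact .inr ⟨a, c, rfl, rfl, h _ _ _ h3 h5⟩

theorem PostRel.refl {R : P → P → Prop} (h : ∀ a, R a a) (m : Option P) : PostRel R m m := by
  cases m with
  | none => exact .inl ⟨rfl, rfl⟩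
  | some a => exact .inr ⟨a, a, rfl, rfl, h a⟩

theorem PostRel.left_some {R : P → P → Prop} {m : Option P} {b : P} (h : PostRel R m (some b)) :
    ∃ a, m = some a ∧ R a b := by
  rcases h with ⟨-, h⟩ | ⟨a, b', rfl, h, h'⟩
  · cases h
  · cases h
    exact ⟨a, rfl, h'⟩

theorem PostRel.right_some {R : P → P → Prop} {m : Option P} {a : P} (h : PostRel R (some a) m) :
    ∃ b, m = some b ∧ R a b := by
  obtain ⟨b, h1, h2⟩ := h.flip.left_some
  exact ⟨b, h1, h2⟩

theorem Sim.mono {R R' : P → P → Prop} (h : ∀ a b, R a b → R' a b) {s t : P}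
    (hs : Sim T sil R s t) : Sim T sil R' s t := by
  intro ℓ m hm
  rcases hs ℓ m hm with ⟨h1, a, b, h2, h3, h4, h5⟩ | ⟨s', m', h1, h2, h3, h4⟩
  · exact .inl ⟨h1, a, b, h2, h3, h _ _ h4, h _ _ h5⟩
  · exact .inr ⟨s', m', h1, h2, h _ _ h3, h4.mono h⟩

theorem Root.mono {R R' : P → P → Prop} (h : ∀ a b, R a b → R' a b) {s t : P}
    (hs : Root T R s t) : Root T R' s t := by
  intro ℓ m hm
  obtain ⟨m', h1, h2⟩ := hs ℓ m hm
  exact ⟨m', h1, h2.mono h⟩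

theorem Root.sim {R : P → P → Prop} {s t : P} (h : Root T R s t) (hst : R s t) :
    Sim T sil R s t := by
  intro ℓ m hm
  obtain ⟨m', h1, h2⟩ := h ℓ m hm
  exact .inr ⟨t, m', .refl, h1, hst, h2⟩

theorem IsSim.quiet {R : P → P → Prop} (hR : IsSim T sil R) {s s' t : P} (h : R s t)
    (hq : Quiet T sil s s') : ∃ t', Quiet T sil t t' ∧ R s' t' := by
  induction hq with
  | refl => exact ⟨t, .refl, h⟩
  | tail _ hstep ih =>
    obtain ⟨t', h1, h2⟩ := ih
    obtain ⟨ℓ, hℓ, hT⟩ := hstep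
    rcases hR _ _ h2 ℓ _ hT with ⟨-, a, b, h3, h4, h5, h6⟩ | ⟨u, m, h3, h4, h5, h6⟩
    · cases h3
      exact ⟨b, h1.trans h4, h6⟩
    · obtain ⟨b, rfl, h7⟩ := h6.right_some
      exact ⟨b, (h1.trans h3).tail ⟨ℓ, hℓ, h4⟩, h7⟩

theorem Sim.comp {R R' R'' : P → P → Prop} (hcomp : ∀ a b c, R a b → R' b c → R'' a c)
    (hR' : IsSim T sil R') {s u t : P} (hsu : Sim T sil R s u) (hut : R' u t) :
    Sim T sil R'' s t := by
  intro ℓ m hm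
  rcases hsu ℓ m hm with ⟨h1, a, b, h2, h3, h4, h5⟩ | ⟨u', m', h1, h2, h3, h4⟩
  · obtain ⟨t', h6, h7⟩ := hR'.quiet hut h3
    exact .inl ⟨h1, a, t', h2, h6, hcomp _ _ _ h4 h7, hcomp _ _ _ h5 h7⟩
  · obtain ⟨t', h6, h7⟩ := hR'.quiet hut h1
    rcases hR' _ _ h7 ℓ m' h2 with ⟨h8, a, b, rfl, h9, h10, h11⟩ | ⟨t'', m'', h8, h9, h10, h11⟩
    · obtain ⟨a', rfl, h12⟩ := h4.left_some
      exact .inl ⟨h8, a', b, rfl, h6.trans h9, hcomp _ _ _ h3 h10, hcomp _ _ _ h12 h11⟩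
    · exact .inr ⟨t'', m'', h6.trans h8, h9, hcomp _ _ _ h3 h10, h4.comp hcomp h11⟩

theorem IsSim.comp {R R' : P → P → Prop} (hR : IsSim T sil R) (hR' : IsSim T sil R') :
    IsSim T sil (Relation.Comp R R') := by
  rintro s t ⟨u, h1, h2⟩
  exact (hR s u h1).comp (fun a b c h h' => ⟨b, h, h'⟩) hR' h2

theorem Bisim.isSim : IsSim T sil (Bisim T sil) := by
  rintro s t ⟨R, h1, h2, h3⟩
  exact (h1 s t h3).mono fun a b h => ⟨R, h1, h2, h⟩

theorem Bisim.refl (s : P) : Bisim T sil s s := by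
  have key : IsSim T sil (fun a b : P => a = b) := by
    rintro s _ rfl ℓ m hm
    exact .inr ⟨s, m, .refl, hm, rfl, PostRel.refl (fun _ => rfl) m⟩
  refine ⟨_, key, ?_, rfl⟩
  convert key using 1
  funext a b
  exact propext eq_comm

theorem Bisim.symm {s t : P} : Bisim T sil s t → Bisim T sil t s :=
  fun ⟨R, h1, h2, h3⟩ => ⟨flip R, h2, h1, h3⟩

theorem Bisim.flip_eq : flip (Bisim T sil) = Bisim T sil := by
  funext a b
  exact propext ⟨Bisim.symm, Bisim.symm⟩

theorem Bisim.trans {s t u : P} (h : Bisim T sil s t) (h' : Bisim T sil t u) :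
    Bisim T sil s u := by
  obtain ⟨R, h1, h2, h3⟩ := h
  obtain ⟨R', h1', h2', h3'⟩ := h'
  refine ⟨_, h1.comp h1', ?_, t, h3, h3'⟩
  rw [Relation.flip_comp]
  exact h2'.comp h2

theorem RBisim.refl (s : P) : RBisim T sil s s :=
  have : Root T (Bisim T sil) s s := fun _ m hm => ⟨m, hm, PostRel.refl Bisim.refl m⟩
  ⟨this, this⟩

theorem RBisim.symm {s t : P} (h : RBisim T sil s t) : RBisim T sil t s := ⟨h.2, h.1⟩

theorem Root.trans {s t u : P} (h : Root T (Bisim T sil) s t) (h' : Root T (Bisim T sil) t u) :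
    Root T (Bisim T sil) s u := by
  intro ℓ m hm
  obtain ⟨m', h1, h2⟩ := h ℓ m hm
  obtain ⟨m'', h3, h4⟩ := h' ℓ m' h1
  exact ⟨m'', h3, h2.comp (R' := Bisim T sil) (fun _ _ _ => Bisim.trans) h4⟩

theorem RBisim.trans {s t u : P} (h : RBisim T sil s t) (h' : RBisim T sil t u) :
    RBisim T sil s u :=
  ⟨h.1.trans h'.1, h'.2.trans h.2⟩

/-- States with the same moves are rooted bisimilar. -/
theorem RBisim.of_moves_iff {s t : P} (h : ∀ ℓ m, T s ℓ m ↔ T t ℓ m) : RBisim T sil s t :=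
  ⟨fun ℓ m hm => ⟨m, (h ℓ m).1 hm, PostRel.refl Bisim.refl m⟩,
    fun ℓ m hm => ⟨m, (h ℓ m).2 hm, PostRel.refl Bisim.refl m⟩⟩

theorem RBisim.bisim {s t : P} (h : RBisim T sil s t) : Bisim T sil s t := by
  have key : IsSim T sil (fun a b => RBisim T sil a b ∨ Bisim T sil a b) := by
    rintro a b (hab | hab)
    · exact (hab.1.mono fun _ _ => Or.inr).sim (.inl hab)
    · exact (Bisim.isSim a b hab).mono fun _ _ => Or.inr
  refine ⟨_, key, ?_, .inl h⟩
  convert key using 1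
  funext a b
  exact propext ⟨Or.imp RBisim.symm Bisim.symm, Or.imp RBisim.symm Bisim.symm⟩

/-- Bisimulation up to bisimilarity. The slack is on the side of the matching place only, so that
weak challenges, too, can be followed step by step. -/
theorem bisim_of_upto {S : P → P → Prop}
    (hf : ∀ s t, S s t → Sim T sil (Relation.Comp S (Bisim T sil)) s t)
    (hb : ∀ s t, S s t → Sim T sil (flip (Relation.Comp (Bisim T sil) S)) t s)
    {s t : P} (h : S s t) : Bisim T sil s t := by
  have h1 : IsSim T sil (Relation.Comp S (Bisim T sil)) := by
    rintro a b ⟨c, hac, hcb⟩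
    exact (hf a c hac).comp (fun _ _ _ ⟨e, h1, h2⟩ h3 => ⟨e, h1, h2.trans h3⟩) Bisim.isSim hcb
  have h2 : IsSim T sil (flip (Relation.Comp (Bisim T sil) S)) := by
    rintro b a ⟨c, hac, hcb⟩
    exact (hb c b hcb).comp (fun _ _ _ ⟨e, h1, h2⟩ h3 => ⟨e, h3.symm.trans h1, h2⟩)
      Bisim.isSim hac.symm
  refine ⟨Relation.Comp (Bisim T sil) (Relation.Comp S (Bisim T sil)), Bisim.isSim.comp h1, ?_,
    s, .refl s, t, h, .refl t⟩
  rw [← Relation.comp_assoc, Relation.flip_comp, Bisim.flip_eq]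
  exact Bisim.isSim.comp h2

/-- The relation `≈ S ≈`. -/
def Around (T : P → A → Option P → Prop) (sil : A → Prop) (S : P → P → Prop) (s t : P) : Prop :=
  ∃ s' t', Bisim T sil s s' ∧ S s' t' ∧ Bisim T sil t' t

theorem isSim_around {S : P → P → Prop}
    (hS : ∀ s t, S s t → ∀ ℓ m, T s ℓ m → ∃ m', T t ℓ m' ∧
      PostRel (Around T sil S) m m' ∧ (sil ℓ → PostRel S m m')) :
    IsSim T sil (Around T sil S) := by
  have hq : ∀ {a a' b : P}, S a b → Quiet T sil a a' → ∃ b', Quiet T sil b b' ∧ S a' b' := by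
    intro a a' b hab hq
    induction hq with
    | refl => exact ⟨b, .refl, hab⟩
    | tail _ hstep ih =>
      obtain ⟨b', h1, h2⟩ := ih
      obtain ⟨ℓ, hℓ, hT⟩ := hstep
      obtain ⟨m', h3, -, h4⟩ := hS _ _ h2 ℓ _ hT
      obtain ⟨c, rfl, h5⟩ := (h4 hℓ).right_some
      exact ⟨c, h1.tail ⟨ℓ, hℓ, h3⟩, h5⟩
  rintro s t ⟨s₀, t₀, h1, h2, h3⟩ ℓ m hm
  rcases Bisim.isSim _ _ h1 ℓ m hm with ⟨h4, a, b, rfl, h5, h6, h7⟩ | ⟨u, m', h4, h5, h6, h7⟩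
  · obtain ⟨b', h8, h9⟩ := hq h2 h5
    obtain ⟨c, h10, h11⟩ := Bisim.isSim.quiet h3 h8
    exact .inl ⟨h4, a, c, rfl, h10, ⟨b, b', h6, h9, h11⟩, ⟨b, b', h7, h9, h11⟩⟩
  · obtain ⟨b', h8, h9⟩ := hq h2 h4
    obtain ⟨c, h10, h11⟩ := Bisim.isSim.quiet h3 h8
    obtain ⟨m'', h12, h13, -⟩ := hS _ _ h9 ℓ m' h5
    have h14 : PostRel (Around T sil S) m m'' :=
      h7.comp (fun _ _ _ h ⟨e, f, h1, h2, h3⟩ => ⟨e, f, h.trans h1, h2, h3⟩) h13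
    rcases Bisim.isSim _ _ h11 ℓ m'' h12 with
      ⟨h15, a, b, rfl, h16, h17, h18⟩ | ⟨v, m₃, h15, h16, h17, h18⟩
    · obtain ⟨a', rfl, e, f, h19, h20, h21⟩ := h14.left_some
      exact .inl ⟨h15, a', b, rfl, h10.trans h16, ⟨u, b', h6, h9, h17⟩,
        ⟨e, f, h19, h20, h21.trans h18⟩⟩
    · exact .inr ⟨v, m₃, h10.trans h15, h16, ⟨u, b', h6, h9, h17⟩,
        h14.comp (fun _ _ _ ⟨e, f, h1, h2, h3⟩ h => ⟨e, f, h1, h2, h3.trans h⟩) h18⟩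

theorem flip_around (S : P → P → Prop) :
    flip (Around T sil S) = Around T sil (flip S) := by
  funext a b
  exact propext ⟨fun ⟨e, f, h1, h2, h3⟩ => ⟨f, e, h3.symm, h2, h1.symm⟩,
    fun ⟨e, f, h1, h2, h3⟩ => ⟨f, e, h3.symm, h2, h1.symm⟩⟩

/-- Bisimulation up to bisimilarity on both sides, which is sound if silent moves are matched
within the relation itself. -/
theorem bisim_of_upto_visible {S : P → P → Prop}
    (hf : ∀ s t, S s t → ∀ ℓ m, T s ℓ m → ∃ m', T t ℓ m' ∧
      PostRel (Around T sil S) m m' ∧ (sil ℓ → PostRel S m m'))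
    (hb : ∀ s t, S s t → ∀ ℓ m, T t ℓ m → ∃ m', T s ℓ m' ∧
      PostRel (Around T sil (flip S)) m m' ∧ (sil ℓ → PostRel (flip S) m m'))
    {s t : P} (h : S s t) : Bisim T sil s t := by
  refine ⟨Around T sil S, isSim_around hf, ?_, s, t, .refl s, h, .refl t⟩
  rw [flip_around]
  exact isSim_around fun a b hab => hb b a hab

end Branching

/-! ### Substitution and transitions of open terms -/

section Substitution

variable {H L K : Type*}

/-- Simultaneous substitution. -/
def Tm.sub (σ : ℕ → Tm H L K) : Tm H L K → Tm H L K
  | .nil => .nil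
  | .pre μ p => .pre μ (p.sub σ)
  | .sum p q => .sum (p.sub σ) (q.sub σ)
  | .con C => .con C
  | .par p q => .par (p.sub σ) (q.sub σ)
  | .var y => σ y

/-- The substitution that replaces only `x`. -/
def single (x : ℕ) (t : Tm H L K) : ℕ → Tm H L K := fun y => if y = x then t else .var y

theorem subst_eq_sub (p : Tm H L K) (x : ℕ) (t : Tm H L K) : p.subst x t = p.sub (single x t) := by
  induction p <;> simp_all [Tm.subst, Tm.sub, single]

theorem sub_sub (p : Tm H L K) (σ ρ : ℕ → Tm H L K) :
    (p.sub σ).sub ρ = p.sub (fun y => (σ y).sub ρ) := by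
  induction p <;> simp_all [Tm.sub]

theorem subst_subst_self (G : Tm H L K) {p : Tm H L K} (s : Tm H L K) {x : ℕ} :
    (G.subst x p).subst x s = G.subst x (p.subst x s) := by
  induction G with
  | var y => by_cases hy : y = x <;> simp [hy, Tm.subst]
  | _ => simp_all [Tm.subst]

theorem Tm.IsClosed.sub_eq {p : Tm H L K} (h : p.IsClosed) (σ : ℕ → Tm H L K) : p.sub σ = p := by
  induction p <;> simp_all [Tm.sub, Tm.IsClosed]

/-- If only `x` occurs in `p`, then a substitution acts on `p` through its value at `x`. -/
theorem sub_eq_subst_of_closed {p c : Tm H L K} {x : ℕ} (h : (p.subst x c).IsClosed)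
    (σ : ℕ → Tm H L K) : p.sub σ = p.subst x (σ x) := by
  induction p with
  | var y =>
    by_cases hy : y = x
    · subst hy; simp [Tm.sub, Tm.subst]
    · simp [Tm.subst, hy, Tm.IsClosed] at h
  | _ => simp_all [Tm.sub, Tm.subst, Tm.IsClosed]

theorem WF.seq_of_grd {p : Tm H L K} (h : WF .grd p) : WF .seq p := .ofGrd h
theorem WF.par_of_grd {p : Tm H L K} (h : WF .grd p) : WF .par p := .ofSeq (.ofGrd h)

theorem wf_grd_pre {μ : Act H L} {p : Tm H L K} : WF .grd (.pre μ p) ↔ WF .seq p :=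
  ⟨fun h => by cases h; assumption, .pre⟩

theorem wf_grd_sum {p q : Tm H L K} : WF .grd (.sum p q) ↔ WF .grd p ∧ WF .grd q :=
  ⟨fun h => by cases h; exact ⟨‹_›, ‹_›⟩, fun h => .sum h.1 h.2⟩

theorem not_wf_grd_con {C : Const K} : ¬ WF .grd (.con C : Tm H L K) := fun h => by cases h
theorem not_wf_grd_var {x : ℕ} : ¬ WF .grd (.var x : Tm H L K) := fun h => by cases h
theorem not_wf_grd_par {p q : Tm H L K} : ¬ WF .grd (.par p q) := fun h => by cases h
theorem not_wf_seq_par {p q : Tm H L K} : ¬ WF .seq (.par p q) := fun h => by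
  cases h with | ofGrd h => cases h

theorem wf_seq_pre {μ : Act H L} {p : Tm H L K} : WF .seq (.pre μ p) ↔ WF .seq p :=
  ⟨fun h => by cases h with | ofGrd h => exact wf_grd_pre.1 h, fun h => .ofGrd (.pre h)⟩

theorem wf_seq_sum {p q : Tm H L K} : WF .seq (.sum p q) ↔ WF .grd p ∧ WF .grd q :=
  ⟨fun h => by cases h with | ofGrd h => exact wf_grd_sum.1 h, fun h => .ofGrd (.sum h.1 h.2)⟩

theorem wf_par_par {p q : Tm H L K} : WF .par (.par p q) ↔ WF .par p ∧ WF .par q :=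
  ⟨fun h => by
    cases h with
    | ofSeq h => exact absurd h not_wf_seq_par
    | par h1 h2 => exact ⟨h1, h2⟩, fun h => .par h.1 h.2⟩

theorem wf_par_pre {μ : Act H L} {p : Tm H L K} : WF .par (.pre μ p) ↔ WF .seq p :=
  ⟨fun h => by cases h with | ofSeq h => exact wf_seq_pre.1 h, fun h => (WF.pre h).par_of_grd⟩

theorem wf_par_sum {p q : Tm H L K} : WF .par (.sum p q) ↔ WF .grd p ∧ WF .grd q :=
  ⟨fun h => by cases h with | ofSeq h => exact wf_seq_sum.1 h,
    fun h => (WF.sum h.1 h.2).par_of_grd⟩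

/-- Sequential terms may be substituted for variables in every category but that of guarded terms,
in which no variable occurs at the top. -/
theorem WF.sub {c : Cat} {p : Tm H L K} (h : WF c p) {σ : ℕ → Tm H L K}
    (hσ : ∀ y, WF .seq (σ y)) : WF c (p.sub σ) := by
  induction h with
  | nil => exact .nil
  | pre _ ih => exact .pre ih
  | sum _ _ ih1 ih2 => exact .sum ih1 ih2
  | ofGrd _ ih => exact .ofGrd ih
  | con C => exact .con C
  | var x => exact hσ x
  | ofSeq _ ih => exact .ofSeq ih
  | par _ _ ih1 ih2 => exact .par ih1 ih2

theorem wf_single {x : ℕ} {t : Tm H L K} (ht : WF .seq t) (y : ℕ) : WF .seq (single x t y) := by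
  unfold single
  split_ifs
  exacts [ht, .var y]

theorem WF.subst {c : Cat} {p : Tm H L K} (h : WF c p) {x : ℕ} {t : Tm H L K} (ht : WF .seq t) :
    WF c (p.subst x t) := by
  rw [subst_eq_sub]
  exact h.sub (wf_single ht)

theorem wf_of_subst_con {C : Const K} {x : ℕ} (p : Tm H L K) :
    (WF .grd (p.subst x (.con C)) → WF .grd p) ∧ (WF .seq (p.subst x (.con C)) → WF .seq p) := by
  induction p with
  | nil => exact ⟨id, id⟩
  | pre μ p ih =>
    exact ⟨fun h => .pre (ih.2 (wf_grd_pre.1 h)), fun h => wf_seq_pre.2 (ih.2 (wf_seq_pre.1 h))⟩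
  | sum p q ihp ihq =>
    exact ⟨fun h => wf_grd_sum.2 ((wf_grd_sum.1 h).imp ihp.1 ihq.1),
      fun h => wf_seq_sum.2 ((wf_seq_sum.1 h).imp ihp.1 ihq.1)⟩
  | con C => exact ⟨id, id⟩
  | par p q _ _ => exact ⟨fun h => absurd h not_wf_grd_par, fun h => absurd h not_wf_seq_par⟩
  | var y =>
    refine ⟨fun h => ?_, fun _ => .var y⟩
    simp only [Tm.subst] at h
    split_ifs at h
    · exact absurd h not_wf_grd_con
    · exact absurd h not_wf_grd_var

theorem subst_eq_nil {p t : Tm H L K} {x : ℕ} (ht : t ≠ .nil) : p.subst x t = .nil ↔ p = .nil := by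
  cases p with
  | var y => by_cases hy : y = x <;> simp [Tm.subst, hy, ht]
  | _ => simp [Tm.subst]

end Substitution

section Restriction

variable {H L K : Type*}

theorem WF.restr {c : Cat} {p : Tm H L K} (h : WF c p) : WF c p.restr := by
  induction h with
  | nil => exact .nil
  | @pre μ q _ ih => cases μ <;> first | exact .pre ih | exact .sum .nil .nil
  | sum _ _ ih1 ih2 => exact .sum ih1 ih2
  | ofGrd _ ih => exact .ofGrd ih
  | con C => exact .con _
  | var x => exact .var x
  | ofSeq _ ih => exact .ofSeq ih
  | par _ _ ih1 ih2 => exact .par ih1 ih2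

theorem restr_restr (p : Tm H L K) : p.restr.restr = p.restr := by
  induction p with
  | pre μ p ih => cases μ <;> simp [Tm.restr, ih]
  | con C => cases C <;> simp [Tm.restr, Const.restr]
  | _ => simp_all [Tm.restr]

theorem Tm.IsClosed.restr {p : Tm H L K} (h : p.IsClosed) : p.restr.IsClosed := by
  induction p with
  | pre μ p ih => cases μ <;> simp_all [Tm.restr, Tm.IsClosed]
  | _ => simp_all [Tm.restr, Tm.IsClosed]

theorem restr_eq_nil {p : Tm H L K} : p.restr = .nil ↔ p = .nil := by
  cases p with
  | pre μ p => cases μ <;> simp [Tm.restr]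
  | _ => simp [Tm.restr]

end Restriction

section Steps

variable {H L K : Type*} {D : Env H L K}

theorem body_grd {C : Const K} {s : Tm H L K} (h : D.body C = some s) : WF .grd s := by
  cases C with
  | base k => exact D.guarded k s h
  | prime k =>
    obtain ⟨s', h1, rfl⟩ := Option.map_eq_some_iff.1 h
    exact (D.guarded k s' h1).restr

theorem body_closed {C : Const K} {s : Tm H L K} (h : D.body C = some s) : s.IsClosed := by
  cases C with
  | base k => exact D.closed k s h
  | prime k =>
    obtain ⟨s', h1, rfl⟩ := Option.map_eq_some_iff.1 h
    exact (D.closed k s' h1).restr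

theorem Step.closed {p p' : Tm H L K} {μ : Act H L} (h : Step D p μ p') (hp : p.IsClosed) :
    p'.IsClosed := by
  induction h with
  | pre => exact hp
  | con hb _ ih => exact ih (body_closed hb)
  | sumL _ ih => exact ih hp.1
  | sumR _ ih => exact ih hp.2
  | parL _ ih => exact ⟨ih hp.1, hp.2⟩
  | parR _ ih => exact ⟨hp.1, ih hp.2⟩

theorem Step.wf_seq {p p' : Tm H L K} {μ : Act H L} (h : Step D p μ p') (hp : WF .seq p) :
    WF .seq p' := by
  induction h with
  | pre => exact wf_seq_pre.1 hp
  | con hb _ ih => exact ih (body_grd hb).seq_of_grd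
  | sumL _ ih => exact ih (wf_seq_sum.1 hp).1.seq_of_grd
  | sumR _ ih => exact ih (wf_seq_sum.1 hp).2.seq_of_grd
  | parL _ _ => exact absurd hp not_wf_seq_par
  | parR _ _ => exact absurd hp not_wf_seq_par

theorem Step.wf_par {p p' : Tm H L K} {μ : Act H L} (h : Step D p μ p') (hp : WF .par p) :
    WF .par p' := by
  induction h with
  | parL _ ih => exact .par (ih (wf_par_par.1 hp).1) (wf_par_par.1 hp).2
  | parR _ ih => exact .par (wf_par_par.1 hp).1 (ih (wf_par_par.1 hp).2)
  | pre => exact .ofSeq (wf_par_pre.1 hp)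
  | con hb _ ih => exact ih (body_grd hb).par_of_grd
  | sumL _ ih => exact ih (wf_par_sum.1 hp).1.par_of_grd
  | sumR _ ih => exact ih (wf_par_sum.1 hp).2.par_of_grd

theorem not_step_nil {p : Tm H L K} {μ : Act H L} : ¬ Step D .nil μ p := fun h => by cases h
theorem not_step_var {x : ℕ} {p : Tm H L K} {μ : Act H L} : ¬ Step D (.var x) μ p :=
  fun h => by cases h

theorem step_pre {μ ν : Act H L} {p p' : Tm H L K} :
    Step D (.pre μ p) ν p' ↔ ν = μ ∧ p' = p :=
  ⟨fun h => by cases h; exact ⟨rfl, rfl⟩, by rintro ⟨rfl, rfl⟩; exact .pre⟩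

theorem step_sum {μ : Act H L} {p q p' : Tm H L K} :
    Step D (.sum p q) μ p' ↔ Step D p μ p' ∨ Step D q μ p' :=
  ⟨fun h => by
    cases h with
    | sumL h => exact .inl h
    | sumR h => exact .inr h, fun h => h.elim .sumL .sumR⟩

theorem step_con {C : Const K} {s p' : Tm H L K} {μ : Act H L} (hb : D.body C = some s) :
    Step D (.con C) μ p' ↔ Step D s μ p' :=
  ⟨fun h => by
    cases h with
    | con hb' h =>
      rw [hb] at hb'
      cases hb'
      exact h, .con hb⟩

theorem Step.sub {p p' : Tm H L K} {μ : Act H L} (h : Step D p μ p') (σ : ℕ → Tm H L K) :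
    Step D (p.sub σ) μ (p'.sub σ) := by
  induction h with
  | pre => exact .pre
  | con hb _ ih => exact .con hb ((body_closed hb).sub_eq σ ▸ ih)
  | sumL _ ih => exact .sumL ih
  | sumR _ ih => exact .sumR ih
  | parL _ ih => exact .parL ih
  | parR _ ih => exact .parR ih

/-- A move of an instance of a guarded term comes from the term: the variables are all behind
prefixes. -/
theorem step_sub_grd {p z : Tm H L K} {μ : Act H L} {σ : ℕ → Tm H L K} (hp : WF .grd p)
    (h : Step D (p.sub σ) μ z) : ∃ p', Step D p μ p' ∧ z = p'.sub σ := by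
  induction p with
  | nil => exact absurd h not_step_nil
  | pre ν p _ =>
    obtain ⟨rfl, rfl⟩ := step_pre.1 h
    exact ⟨p, .pre, rfl⟩
  | sum p q ihp ihq =>
    rcases step_sum.1 h with h | h
    · obtain ⟨p', h1, h2⟩ := ihp (wf_grd_sum.1 hp).1 h
      exact ⟨p', .sumL h1, h2⟩
    · obtain ⟨p', h1, h2⟩ := ihq (wf_grd_sum.1 hp).2 h
      exact ⟨p', .sumR h1, h2⟩
  | con C => exact absurd hp not_wf_grd_con
  | par p q _ _ => exact absurd hp not_wf_grd_par
  | var x => exact absurd hp not_wf_grd_var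

theorem step_sub_seq {p z : Tm H L K} {μ : Act H L} {σ : ℕ → Tm H L K} (hp : WF .seq p)
    (h : Step D (p.sub σ) μ z) :
    (∃ p', Step D p μ p' ∧ z = p'.sub σ) ∨ ∃ y, p = .var y ∧ Step D (σ y) μ z := by
  cases hp with
  | ofGrd hp => exact .inl (step_sub_grd hp h)
  | con C => exact .inl ⟨z, h, ((h.closed trivial).sub_eq σ).symm⟩
  | var y => exact .inr ⟨y, rfl, h⟩

theorem Step.subst {p p' : Tm H L K} {μ : Act H L} (h : Step D p μ p') (x : ℕ) (t : Tm H L K) :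
    Step D (p.subst x t) μ (p'.subst x t) := by
  simp only [subst_eq_sub]
  exact h.sub _

theorem step_subst_grd {p z t : Tm H L K} {μ : Act H L} {x : ℕ} (hp : WF .grd p)
    (h : Step D (p.subst x t) μ z) : ∃ p', Step D p μ p' ∧ z = p'.subst x t := by
  simp only [subst_eq_sub] at h ⊢
  exact step_sub_grd hp h

theorem step_subst_seq {p z t : Tm H L K} {μ : Act H L} {x : ℕ} (hp : WF .seq p)
    (h : Step D (p.subst x t) μ z) :
    (∃ p', Step D p μ p' ∧ z = p'.subst x t) ∨ p = .var x ∧ Step D t μ z := by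
  simp only [subst_eq_sub] at h ⊢
  rcases step_sub_seq hp h with h | ⟨y, rfl, h⟩
  · exact .inl h
  · by_cases hy : y = x
    · subst hy
      exact .inr ⟨rfl, by simpa [single, Tm.sub] using h⟩
    · simp only [Tm.sub, single, hy, if_false] at h
      exact absurd h not_step_var

theorem init_iff {p : Tm H L K} {μ : Act H L} : Init D p μ ↔ ∃ p', Step D p μ p' := by
  constructor
  · intro h
    induction h with
    | pre => exact ⟨_, .pre⟩
    | sumL _ ih => exact ih.imp fun _ => .sumL
    | sumR _ ih => exact ih.imp fun _ => .sumR
    | parL _ ih => exact ih.elim fun _ h => ⟨_, .parL h⟩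
    | parR _ ih => exact ih.elim fun _ h => ⟨_, .parR h⟩
    | con hb _ ih => exact ih.imp fun _ => .con hb
  · rintro ⟨p', h⟩
    induction h with
    | pre => exact .pre
    | sumL _ ih => exact .sumL ih
    | sumR _ ih => exact .sumR ih
    | parL _ ih => exact .parL ih
    | parR _ ih => exact .parR ih
    | con hb _ ih => exact .con hb ih

theorem Step.restr {p p' : Tm H L K} {μ : Act H L} (h : Step D p μ p') (hμ : ¬ μ.IsHigh) :
    Step D p.restr μ p'.restr := by
  induction h with
  | @pre μ p =>
    cases μ with
    | high h => exact absurd trivial hμ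
    | low l => exact .pre
    | tau => exact .pre
  | @con μ C s p' hb _ ih =>
    refine .con (p := s.restr) ?_ (ih hμ)
    cases C with
    | base k => exact Option.map_eq_some_iff.2 ⟨s, hb, rfl⟩
    | prime k =>
      obtain ⟨s', h1, rfl⟩ := Option.map_eq_some_iff.1 hb
      simp [Const.restr, Env.body, h1, restr_restr]
  | sumL _ ih => exact .sumL (ih hμ)
  | sumR _ ih => exact .sumR (ih hμ)
  | parL _ ih => exact .parL (ih hμ)
  | parR _ ih => exact .parR (ih hμ)

theorem step_restr {p z : Tm H L K} {μ : Act H L} (h : Step D p.restr μ z) :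
    ¬ μ.IsHigh ∧ ∃ p', Step D p μ p' ∧ z = p'.restr := by
  generalize hr : p.restr = r at h
  induction h generalizing p with
  | @pre μ q =>
    cases p with
    | pre ν p =>
      cases ν <;> simp only [Tm.restr, reduceCtorEq, Tm.pre.injEq] at hr
      all_goals
        obtain ⟨rfl, rfl⟩ := hr
        exact ⟨id, p, .pre, rfl⟩
    | _ => simp [Tm.restr] at hr
  | @con μ C s z hb hs ih =>
    cases p with
    | con C₀ =>
      simp only [Tm.restr, Tm.con.injEq] at hr
      subst hr
      cases C₀ with
      | base k =>
        obtain ⟨s', h1, rfl⟩ := Option.map_eq_some_iff.1 hb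
        obtain ⟨h2, p', h3, h4⟩ := ih rfl
        exact ⟨h2, p', .con h1 h3, h4⟩
      | prime k =>
        obtain ⟨s', h1, rfl⟩ := Option.map_eq_some_iff.1 hb
        obtain ⟨h2, p', h3, h4⟩ := ih (restr_restr s')
        exact ⟨h2, p', .con hb h3, h4⟩
    | pre ν p => cases ν <;> simp [Tm.restr] at hr
    | _ => simp [Tm.restr] at hr
  | sumL hs ih =>
    cases p with
    | sum p q =>
      simp only [Tm.restr, Tm.sum.injEq] at hr
      obtain ⟨h2, p', h3, h4⟩ := ih hr.1
      exact ⟨h2, p', .sumL h3, h4⟩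
    | pre ν p =>
      cases ν <;> simp only [Tm.restr, reduceCtorEq, Tm.sum.injEq] at hr
      obtain ⟨rfl, rfl⟩ := hr
      exact absurd hs not_step_nil
    | _ => simp [Tm.restr] at hr
  | sumR hs ih =>
    cases p with
    | sum p q =>
      simp only [Tm.restr, Tm.sum.injEq] at hr
      obtain ⟨h2, p', h3, h4⟩ := ih hr.2
      exact ⟨h2, p', .sumR h3, h4⟩
    | pre ν p =>
      cases ν <;> simp only [Tm.restr, reduceCtorEq, Tm.sum.injEq] at hr
      obtain ⟨rfl, rfl⟩ := hr
      exact absurd hs not_step_nil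
    | _ => simp [Tm.restr] at hr
  | parL hs ih =>
    cases p with
    | par p q =>
      simp only [Tm.restr, Tm.par.injEq] at hr
      obtain ⟨h2, p', h3, h4⟩ := ih hr.1
      exact ⟨h2, .par p' q, .parL h3, by simp [Tm.restr, h4, hr.2]⟩
    | pre ν p => cases ν <;> simp [Tm.restr] at hr
    | _ => simp [Tm.restr] at hr
  | parR hs ih =>
    cases p with
    | par p q =>
      simp only [Tm.restr, Tm.par.injEq] at hr
      obtain ⟨h2, p', h3, h4⟩ := ih hr.2
      exact ⟨h2, .par p p', .parR h3, by simp [Tm.restr, h4, hr.1]⟩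
    | pre ν p => cases ν <;> simp [Tm.restr] at hr
    | _ => simp [Tm.restr] at hr

end Steps

/-! ### Equivalence of open terms -/

section Equivalence

variable {H L K : Type*} (D : Env H L K) (ok : Act H L → Prop) (sil : Act H L → Prop)

/-- The net transitions between sequential terms, of which only those with a label in `ok` are
kept. -/
def Tr (s : Tm H L K) (ℓ : Act H L) (m : Option (Tm H L K)) : Prop :=
  ok ℓ ∧ ∃ s', Step D s ℓ s' ∧ m = post s'

/-- The additive closure of rooted branching bisimilarity, on the markings of two terms. -/
def Eqv (p q : Tm H L K) : Prop := Multiset.Rel (RBisim (Tr D ok) sil) (dec p) (dec q)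

variable {D ok sil}

theorem tr_nil {ℓ : Act H L} {m : Option (Tm H L K)} : Tr D ok .nil ℓ m ↔ False :=
  ⟨fun ⟨_, _, h, _⟩ => not_step_nil h, False.elim⟩

theorem tr_pre {μ ℓ : Act H L} {p : Tm H L K} {m : Option (Tm H L K)} :
    Tr D ok (.pre μ p) ℓ m ↔ ok ℓ ∧ ℓ = μ ∧ m = post p := by
  simp only [Tr, step_pre]
  constructor
  · rintro ⟨h, _, ⟨h1, rfl⟩, h2⟩
    exact ⟨h, h1, h2⟩
  · rintro ⟨h, h1, h2⟩
    exact ⟨h, p, ⟨h1, rfl⟩, h2⟩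

theorem tr_sum {ℓ : Act H L} {p q : Tm H L K} {m : Option (Tm H L K)} :
    Tr D ok (.sum p q) ℓ m ↔ Tr D ok p ℓ m ∨ Tr D ok q ℓ m := by
  simp only [Tr, step_sum, or_and_right, exists_or, and_or_left]

theorem tr_con {C : Const K} {s : Tm H L K} (hb : D.body C = some s) {ℓ : Act H L}
    {m : Option (Tm H L K)} : Tr D ok (.con C) ℓ m ↔ Tr D ok s ℓ m := by
  simp only [Tr, step_con hb]

theorem post_eq_none {p : Tm H L K} : post p = none ↔ p = .nil := by cases p <;> simp [post]

theorem post_of_ne {p : Tm H L K} (h : p ≠ .nil) : post p = some p := by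
  cases p <;> simp_all [post]

theorem post_eq_some {p a : Tm H L K} : post p = some a ↔ p ≠ .nil ∧ a = p := by
  cases p <;> simp [post, eq_comm]

theorem dec_of_seq {p : Tm H L K} (hp : WF .seq p) (h : p ≠ .nil) : dec p = {p} := by
  cases p with
  | nil => exact absurd rfl h
  | par p q => exact absurd hp not_wf_seq_par
  | _ => rfl

theorem postRel_post {R : Tm H L K → Tm H L K → Prop} {p q : Tm H L K}
    (h : p = .nil ↔ q = .nil) (hR : p ≠ .nil → q ≠ .nil → R p q) :
    PostRel R (post p) (post q) := by
  by_cases hp : p = .nil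
  · exact .inl ⟨post_eq_none.2 hp, post_eq_none.2 (h.1 hp)⟩
  · have hq : q ≠ .nil := fun hq => hp (h.2 hq)
    exact .inr ⟨p, q, post_of_ne hp, post_of_ne hq, hR hp hq⟩

theorem of_postRel_post {R : Tm H L K → Tm H L K → Prop} {p q : Tm H L K}
    (h : PostRel R (post p) (post q)) : p = .nil ∧ q = .nil ∨ p ≠ .nil ∧ q ≠ .nil ∧ R p q := by
  rcases h with ⟨h1, h2⟩ | ⟨a, b, h1, h2, h3⟩
  · exact .inl ⟨post_eq_none.1 h1, post_eq_none.1 h2⟩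
  · obtain ⟨h4, rfl⟩ := post_eq_some.1 h1
    obtain ⟨h5, rfl⟩ := post_eq_some.1 h2
    exact .inr ⟨h4, h5, h3⟩

/-- On sequential terms, equivalence is rooted bisimilarity together with the requirement that `0`,
whose marking is empty, is equivalent only to itself. -/
theorem eqv_seq {p q : Tm H L K} (hp : WF .seq p) (hq : WF .seq q) :
    Eqv D ok sil p q ↔ (p = .nil ↔ q = .nil) ∧ RBisim (Tr D ok) sil p q := by
  by_cases h1 : p = .nil <;> by_cases h2 : q = .nil
  · subst h1 h2
    simp [Eqv, dec, RBisim.refl]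
  · subst h1
    simp [Eqv, dec_of_seq hq h2, dec, h2, Multiset.rel_zero_left]
  · subst h2
    simp [Eqv, dec_of_seq hp h1, dec, h1, Multiset.rel_zero_right]
  · simp [Eqv, dec_of_seq hq h2, dec_of_seq hp h1, h1, h2,
      ← Multiset.cons_zero, Multiset.rel_cons_right]

theorem Eqv.refl (p : Tm H L K) : Eqv D ok sil p p :=
  Multiset.rel_refl_of_refl_on fun _ _ => RBisim.refl _

theorem Eqv.symm {p q : Tm H L K} (h : Eqv D ok sil p q) : Eqv D ok sil q p :=
  Multiset.rel_flip.1 (h.mono fun _ _ _ _ h => h.symm)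

theorem Eqv.trans {p q r : Tm H L K} (h : Eqv D ok sil p q) (h' : Eqv D ok sil q r) :
    Eqv D ok sil p r := by
  have : IsTrans _ (RBisim (Tr D ok) sil) := ⟨fun _ _ _ => RBisim.trans⟩
  exact Multiset.Rel.trans _ h h'

theorem Eqv.par {p q p' q' : Tm H L K} (h : Eqv D ok sil p p') (h' : Eqv D ok sil q q') :
    Eqv D ok sil (.par p q) (.par p' q') :=
  Multiset.Rel.add h h'

theorem Eqv.postRel {p q : Tm H L K} (hp : WF .seq p) (hq : WF .seq q)
    (h : Eqv D ok sil p q) : PostRel (Bisim (Tr D ok) sil) (post p) (post q) :=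
  postRel_post ((eqv_seq hp hq).1 h).1 fun _ _ => ((eqv_seq hp hq).1 h).2.bisim

theorem root_pre {R : Tm H L K → Tm H L K → Prop} {μ : Act H L} {p q : Tm H L K}
    (h : PostRel R (post p) (post q)) : Root (Tr D ok) R (.pre μ p) (.pre μ q) := by
  intro ℓ m hm
  obtain ⟨h1, h2, rfl⟩ := tr_pre.1 hm
  exact ⟨_, tr_pre.2 ⟨h1, h2, rfl⟩, h⟩

theorem Eqv.pre {μ : Act H L} {p q : Tm H L K} (hp : WF .seq p) (hq : WF .seq q)
    (h : Eqv D ok sil p q) : Eqv D ok sil (.pre μ p) (.pre μ q) :=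
  (eqv_seq (wf_seq_pre.2 hp) (wf_seq_pre.2 hq)).2
    ⟨by simp, root_pre (h.postRel hp hq), root_pre (h.symm.postRel hq hp)⟩

theorem Root.sum {R : Tm H L K → Tm H L K → Prop} {p q p' q' : Tm H L K}
    (h : Root (Tr D ok) R p p') (h' : Root (Tr D ok) R q q') :
    Root (Tr D ok) R (.sum p q) (.sum p' q') := by
  intro ℓ m hm
  rcases tr_sum.1 hm with hm | hm
  · obtain ⟨m', h1, h2⟩ := h ℓ m hm
    exact ⟨m', tr_sum.2 (.inl h1), h2⟩
  · obtain ⟨m', h1, h2⟩ := h' ℓ m hm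
    exact ⟨m', tr_sum.2 (.inr h1), h2⟩

theorem Eqv.sum {p q p' q' : Tm H L K} (hp : WF .grd p) (hq : WF .grd q) (hp' : WF .grd p')
    (hq' : WF .grd q') (h : Eqv D ok sil p p') (h' : Eqv D ok sil q q') :
    Eqv D ok sil (.sum p q) (.sum p' q') := by
  have h1 := ((eqv_seq hp.seq_of_grd hp'.seq_of_grd).1 h).2
  have h2 := ((eqv_seq hq.seq_of_grd hq'.seq_of_grd).1 h').2
  exact (eqv_seq (WF.sum hp hq).seq_of_grd (WF.sum hp' hq').seq_of_grd).2
    ⟨by simp, h1.1.sum h2.1, h1.2.sum h2.2⟩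

/-- Nonempty-marked sequential terms with the same moves are equivalent. -/
theorem eqv_of_tr_iff {p q : Tm H L K} (hp : WF .seq p) (hq : WF .seq q) (hp0 : p ≠ .nil)
    (hq0 : q ≠ .nil) (h : ∀ ℓ m, Tr D ok p ℓ m ↔ Tr D ok q ℓ m) : Eqv D ok sil p q :=
  (eqv_seq hp hq).2 ⟨by simp [hp0, hq0], RBisim.of_moves_iff h⟩

theorem eqv_con_of_rbisim {A B : Const K}
    (h : RBisim (Tr D ok) sil (.con A : Tm H L K) (.con B)) :
    Eqv D ok sil (.con A : Tm H L K) (.con B) :=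
  (eqv_seq (.con A) (.con B)).2 ⟨by simp, h⟩

/-! ### Recursion -/

/-- If a relation contains the instances `(G{c/x}, G{d/x})` for all `G`, then instances of guarded
terms match each other's moves. -/
theorem root_subst_grd {S : Tm H L K → Tm H L K → Prop} {x : ℕ} {c d : Tm H L K} (hc : c ≠ .nil)
    (hd : d ≠ .nil) (hS : ∀ G, WF .seq G → S (G.subst x c) (G.subst x d)) {p : Tm H L K}
    (hp : WF .grd p) : Root (Tr D ok) S (p.subst x c) (p.subst x d) := by
  rintro ℓ _ ⟨hℓ, z, hz, rfl⟩
  obtain ⟨p', h1, rfl⟩ := step_subst_grd hp hz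
  exact ⟨_, ⟨hℓ, _, h1.subst x d, rfl⟩, postRel_post (by rw [subst_eq_nil hc, subst_eq_nil hd])
    fun _ _ => hS p' (h1.wf_seq hp.seq_of_grd)⟩

theorem root_subst_seq {S : Tm H L K → Tm H L K → Prop} {x : ℕ} {c d : Tm H L K} (hc : c ≠ .nil)
    (hd : d ≠ .nil) (hS : ∀ G, WF .seq G → S (G.subst x c) (G.subst x d))
    (h : Root (Tr D ok) S c d) {p : Tm H L K} (hp : WF .seq p) :
    Root (Tr D ok) S (p.subst x c) (p.subst x d) := by
  rintro ℓ _ ⟨hℓ, z, hz, rfl⟩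
  rcases step_subst_seq hp hz with ⟨p', h1, rfl⟩ | ⟨rfl, hz'⟩
  · exact ⟨_, ⟨hℓ, _, h1.subst x d, rfl⟩,
      postRel_post (by rw [subst_eq_nil hc, subst_eq_nil hd]) fun _ _ => hS p' (h1.wf_seq hp)⟩
  · simpa [Tm.subst] using h ℓ _ ⟨hℓ, z, hz', rfl⟩

/-- Replacing a sequential term by an equivalent one in a context. -/
theorem bisim_subst {x : ℕ} {c d : Tm H L K} (hc : c ≠ .nil)
    (hd : d ≠ .nil) (h : RBisim (Tr D ok) sil c d) {G : Tm H L K} (hG : WF .seq G) :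
    Bisim (Tr D ok) sil (G.subst x c) (G.subst x d) := by
  -- The identity is added because the successors of `c` and `d` may contain `x` themselves.
  let S : Tm H L K → Tm H L K → Prop := fun s t =>
    (∃ G, WF .seq G ∧ s = G.subst x c ∧ t = G.subst x d) ∨ s = t
  refine bisim_of_upto (S := S) ?_ ?_ (.inl ⟨G, hG, rfl, rfl⟩)
  · rintro s t (⟨G, hG, rfl, rfl⟩ | rfl)
    · exact (root_subst_seq hc hd (fun G hG => ⟨_, .inl ⟨G, hG, rfl, rfl⟩, .refl _⟩)
        (h.1.mono fun a b hab => ⟨a, .inr rfl, hab⟩) hG).sim ⟨_, .inl ⟨G, hG, rfl, rfl⟩, .refl _⟩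
    · exact (Bisim.isSim s s (.refl s)).mono fun a b hab => ⟨a, .inr rfl, hab⟩
  · rintro s t (⟨G, hG, rfl, rfl⟩ | rfl)
    · exact (root_subst_seq hd hc (fun G hG => ⟨_, .refl _, .inl ⟨G, hG, rfl, rfl⟩⟩)
        (h.2.mono fun a b hab => ⟨a, hab.symm, .inr rfl⟩) hG).sim
        ⟨_, .refl _, .inl ⟨G, hG, rfl, rfl⟩⟩
    · exact (Bisim.isSim s s (.refl s)).mono fun a b hab => ⟨a, hab.symm, .inr rfl⟩

/-- Soundness of the recursion rule: constants with equivalent bodies are equivalent. -/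
theorem rbisim_of_body {p q : Tm H L K} {A B : Const K} {x : ℕ}
    (h : ∀ C : Const K, Eqv D ok sil (p.subst x (.con C)) (q.subst x (.con C)))
    (hA : D.body A = some (p.subst x (.con A))) (hB : D.body B = some (q.subst x (.con B))) :
    RBisim (Tr D ok) sil (.con A : Tm H L K) (.con B) := by
  have hp : WF .grd p := (wf_of_subst_con p).1 (body_grd hA)
  have hq : WF .grd q := (wf_of_subst_con q).1 (body_grd hB)
  have hE : ∀ C : Const K, RBisim (Tr D ok) sil (p.subst x (.con C)) (q.subst x (.con C)) :=
    fun C => ((eqv_seq (hp.subst (.con C)).seq_of_grd (hq.subst (.con C)).seq_of_grd).1 (h C)).2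
  let S : Tm H L K → Tm H L K → Prop := fun s t =>
    ∃ G, WF .seq G ∧ s = G.subst x (.con A) ∧ t = G.subst x (.con B)
  have hS : ∀ G, WF .seq G → S (G.subst x (.con A)) (G.subst x (.con B)) :=
    fun G hG => ⟨G, hG, rfl, rfl⟩
  have nA : (.con A : Tm H L K) ≠ .nil := by simp
  have nB : (.con B : Tm H L K) ≠ .nil := by simp
  have h1 : Root (Tr D ok) (Relation.Comp S (Bisim (Tr D ok) sil)) (.con A) (.con B) := by
    intro ℓ m hm
    obtain ⟨m', h1, h2⟩ := root_subst_grd nA nB hS hp ℓ m ((tr_con hA).1 hm)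
    obtain ⟨m'', h3, h4⟩ := (hE B).1 ℓ m' h1
    exact ⟨m'', (tr_con hB).2 h3, h2.comp (fun a b c h h' => ⟨b, h, h'⟩) h4⟩
  have h2 : Root (Tr D ok) (flip (Relation.Comp (Bisim (Tr D ok) sil) S)) (.con B) (.con A) := by
    intro ℓ m hm
    obtain ⟨m', h1, h2⟩ := root_subst_grd (S := flip S) nB nA hS hq ℓ m ((tr_con hB).1 hm)
    obtain ⟨m'', h3, h4⟩ := (hE A).2 ℓ m' h1
    exact ⟨m'', (tr_con hA).2 h3, h2.comp (fun a b c h h' => ⟨b, h'.symm, h⟩) h4⟩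
  have hbis : ∀ s t, S s t → Bisim (Tr D ok) sil s t := by
    intro s t hst
    refine bisim_of_upto (S := S) ?_ ?_ hst
    · rintro s t ⟨G, hG, rfl, rfl⟩
      exact (root_subst_seq nA nB (fun G hG => ⟨_, hS G hG, .refl _⟩) h1 hG).sim
        ⟨_, hS G hG, .refl _⟩
    · rintro s t ⟨G, hG, rfl, rfl⟩
      exact (root_subst_seq nB nA (fun G hG => ⟨_, .refl _, hS G hG⟩) h2 hG).sim
        ⟨_, .refl _, hS G hG⟩
  exact ⟨h1.mono fun a b ⟨c, h, h'⟩ => (hbis _ _ h).trans h',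
    h2.mono fun a b ⟨c, h, h'⟩ => (hbis _ _ h').symm.trans h.symm⟩

/-- A bisimulation argument for two constants: pairs of instances of a term by the two constants
need no attention beyond the initial moves of the constants. -/
theorem rbisim_of_contexts {S : Tm H L K → Tm H L K → Prop} {x : ℕ} {A B : Const K}
    (hctx : ∀ G, WF .seq G → S (G.subst x (.con A)) (G.subst x (.con B)))
    (hS : ∀ s t, S s t → (∃ G, WF .seq G ∧ s = G.subst x (.con A) ∧ t = G.subst x (.con B)) ∨
      Sim (Tr D ok) sil S s t ∧ Sim (Tr D ok) sil (flip S) t s)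
    (h1 : Root (Tr D ok) S (.con A) (.con B)) (h2 : Root (Tr D ok) (flip S) (.con B) (.con A)) :
    RBisim (Tr D ok) sil (.con A : Tm H L K) (.con B) := by
  have hbis : ∀ s t, S s t → Bisim (Tr D ok) sil s t := by
    refine fun s t hst => ⟨S, ?_, ?_, hst⟩
    · intro s t hst
      rcases hS s t hst with ⟨G, hG, rfl, rfl⟩ | h
      · exact (root_subst_seq (by simp) (by simp) hctx h1 hG).sim hst
      · exact h.1
    · intro t s hst
      rcases hS s t hst with ⟨G, hG, rfl, rfl⟩ | h
      · exact (root_subst_seq (S := flip S) (by simp) (by simp) hctx h2 hG).sim hst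
      · exact h.2
  exact ⟨h1.mono hbis, h2.mono fun a b h => (hbis b a h).symm⟩

end Equivalence

/-! ### The laws for silent moves -/

section SilentLaws

variable {H L K : Type*} {D : Env H L K} {ok : Act H L → Prop}

/-- Silent computations between terms. -/
def TauSteps (D : Env H L K) : Tm H L K → Tm H L K → Prop :=
  Relation.ReflTransGen fun a b => Step D a .tau b

theorem TauSteps.quiet (hok : ok .tau) {a b : Tm H L K} (h : TauSteps D a b) (hb : b ≠ .nil) :
    Quiet (Tr D ok) (· = .tau) a b := by
  induction h with
  | refl => exact .refl
  | @tail b c _ hs ih =>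
    have hb' : b ≠ .nil := by rintro rfl; exact not_step_nil hs
    exact (ih hb').tail ⟨.tau, rfl, hok, c, hs, (post_of_ne hb).symm⟩

theorem quiet_of_tr {a b : Tm H L K} (h : Tr D ok a .tau (some b)) :
    Quiet (Tr D ok) (· = .tau) a b :=
  .single ⟨.tau, rfl, h⟩

theorem TauSteps.subst {a b : Tm H L K} (h : TauSteps D a b) (x : ℕ) (t : Tm H L K) :
    TauSteps D (a.subst x t) (b.subst x t) := by
  induction h with
  | refl => exact .refl
  | tail _ hs ih => exact ih.tail (hs.subst x t)

/-- A silent path to an unguarded variable; in a guarded term it starts with a move, which a sum can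
make as well. -/
theorem tauSteps_var_of_unguarded {x : ℕ} (q : Tm H L K) :
    (WF .grd q → q.Unguarded x → ∃ q', Step D q .tau q' ∧ TauSteps D q' (.var x)) ∧
      (WF .seq q → q.Unguarded x → TauSteps D q (.var x)) := by
  have key : ∀ q : Tm H L K,
      (WF .grd q → q.Unguarded x → ∃ q', Step D q .tau q' ∧ TauSteps D q' (.var x)) →
      WF .grd q → q.Unguarded x → TauSteps D q (.var x) :=
    fun q h h1 h2 => (h h1 h2).elim fun q' h => .head h.1 h.2
  induction q with
  | nil => exact ⟨fun _ h => h.elim, fun _ h => h.elim⟩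
  | pre μ p ih =>
    have h : WF .grd (.pre μ p) → (Tm.pre μ p).Unguarded x →
        ∃ q', Step D (.pre μ p) .tau q' ∧ TauSteps D q' (.var x) := by
      intro h1 h2
      cases μ with
      | tau => exact ⟨p, .pre, ih.2 (wf_grd_pre.1 h1) h2⟩
      | _ => exact h2.elim
    exact ⟨h, fun h1 => key _ h (.pre (wf_seq_pre.1 h1))⟩
  | sum p q ihp ihq =>
    have h : WF .grd (.sum p q) → (Tm.sum p q).Unguarded x →
        ∃ q', Step D (.sum p q) .tau q' ∧ TauSteps D q' (.var x) := by
      rintro h1 (h2 | h2)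
      · exact (ihp.1 (wf_grd_sum.1 h1).1 h2).imp fun _ h => ⟨.sumL h.1, h.2⟩
      · exact (ihq.1 (wf_grd_sum.1 h1).2 h2).imp fun _ h => ⟨.sumR h.1, h.2⟩
    exact ⟨h, fun h1 => key _ h (wf_grd_sum.2 (wf_seq_sum.1 h1))⟩
  | con C => exact ⟨fun _ h => h.elim, fun _ h => h.elim⟩
  | par p q _ _ => exact ⟨fun h => absurd h not_wf_grd_par, fun h => absurd h not_wf_seq_par⟩
  | var y =>
    refine ⟨fun h => absurd h not_wf_grd_var, fun _ h => ?_⟩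
    rw [show y = x from h]
    exact .refl

theorem quiet_of_unguarded (hok : ok .tau) {x : ℕ} {q t : Tm H L K} (hq : WF .seq q)
    (h : q.Unguarded x) (ht : t ≠ .nil) : Quiet (Tr D ok) (· = .tau) (q.subst x t) t := by
  have := (((tauSteps_var_of_unguarded q).2 hq h).subst (D := D) x t).quiet hok
    (by simpa [Tm.subst] using ht)
  simpa [Tm.subst] using this

/-- If `p` cannot silently reach `x`, then neither can any context in which `x` has been unfolded to
`p`. -/
theorem not_tauSteps_subst_var {x : ℕ} {p : Tm H L K} (hp : WF .grd p)
    (hsafe : ¬ TauSteps D p (.var x)) {G : Tm H L K} (hG : WF .seq G) :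
    ¬ TauSteps D (G.subst x p) (.var x) := by
  intro h
  generalize hs : G.subst x p = s at h
  induction h using Relation.ReflTransGen.head_induction_on generalizing G with
  | refl =>
    cases G <;> simp only [Tm.subst, reduceCtorEq] at hs
    split_ifs at hs with hy
    · subst hs
      exact not_wf_grd_var hp
    · exact hy (Tm.var.inj hs)
  | head hstep hrest ih =>
    subst hs
    rcases step_subst_seq hG hstep with ⟨G', h1, rfl⟩ | ⟨rfl, h1⟩
    · exact ih (h1.wf_seq hG) rfl
    · exact hsafe (.head h1 hrest)

/-- Replacement in contexts `G` from which no silent computation leads to the variable `x`: if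
`C ≐ p{C/x}` and `t = p{t/x}`, then silent moves of `G{C/x}` and `G{t/x}` are made by `G`, and after
a visible move the property can be restored by unfolding `x` once. -/
theorem bisim_subst_of_safe {x : ℕ} {p t : Tm H L K} {C : Const K}
    (hb : D.body C = some (p.subst x (.con C))) (hp : WF .grd p)
    (hp0 : p ≠ .nil) (hsafe : ¬ TauSteps D p (.var x)) (ht0 : t ≠ .nil)
    (h : RBisim (Tr D ok) (· = .tau) t (p.subst x t)) {G : Tm H L K} (hG : WF .seq G)
    (hGs : ¬ TauSteps D G (.var x)) :
    Bisim (Tr D ok) (· = .tau) (G.subst x (.con C)) (G.subst x t) := by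
  have hC : RBisim (Tr D ok) (· = .tau) (.con C) (p.subst x (.con C)) :=
    .of_moves_iff fun _ _ => tr_con hb
  have nC : (.con C : Tm H L K) ≠ .nil := by simp
  let S : Tm H L K → Tm H L K → Prop := fun s u =>
    ∃ G, WF .seq G ∧ ¬ TauSteps D G (.var x) ∧ s = G.subst x (.con C) ∧ u = G.subst x t
  have hA : ∀ G, WF .seq G →
      Around (Tr D ok) (· = .tau) S (G.subst x (.con C)) (G.subst x t) := by
    intro G hG
    refine ⟨_, _, bisim_subst nC (by rwa [Ne, subst_eq_nil nC]) hC hG, ?_,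
      (bisim_subst ht0 (by rwa [Ne, subst_eq_nil ht0]) h hG).symm⟩
    exact ⟨_, hG.subst hp.seq_of_grd, not_tauSteps_subst_var hp hsafe hG,
      (subst_subst_self G _).symm, (subst_subst_self G _).symm⟩
  refine bisim_of_upto_visible (S := S) ?_ ?_ ⟨G, hG, hGs, rfl, rfl⟩
  · rintro _ _ ⟨G, hG, hGs, rfl, rfl⟩ ℓ _ ⟨hℓ, z, hz, rfl⟩
    rcases step_subst_seq hG hz with ⟨G', h1, rfl⟩ | ⟨rfl, -⟩
    · have hnil : G'.subst x (.con C) = .nil ↔ G'.subst x t = .nil := by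
        rw [subst_eq_nil nC, subst_eq_nil ht0]
      refine ⟨_, ⟨hℓ, _, h1.subst x t, rfl⟩,
        postRel_post hnil fun _ _ => hA G' (h1.wf_seq hG), ?_⟩
      rintro rfl
      exact postRel_post hnil fun _ _ => ⟨G', h1.wf_seq hG, fun h => hGs (.head h1 h), rfl, rfl⟩
    · exact absurd .refl hGs
  · rintro _ _ ⟨G, hG, hGs, rfl, rfl⟩ ℓ _ ⟨hℓ, z, hz, rfl⟩
    rcases step_subst_seq hG hz with ⟨G', h1, rfl⟩ | ⟨rfl, -⟩
    · have hnil : G'.subst x t = .nil ↔ G'.subst x (.con C) = .nil := by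
        rw [subst_eq_nil nC, subst_eq_nil ht0]
      refine ⟨_, ⟨hℓ, _, h1.subst x _, rfl⟩,
        postRel_post hnil fun _ _ => ?_, ?_⟩
      · rw [← flip_around]
        exact hA G' (h1.wf_seq hG)
      rintro rfl
      exact postRel_post hnil fun _ _ => ⟨G', h1.wf_seq hG, fun h => hGs (.head h1 h), rfl, rfl⟩
    · exact absurd .refl hGs

/-- Soundness of `R3`: an equation without silent cycle has at most one solution. -/
theorem eqv_of_unique_solution {x : ℕ} {p t : Tm H L K} {C : Const K}
    (hb : D.body C = some (p.subst x (.con C))) (hp0 : p ≠ .nil) (hog : ObsGuarded D C)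
    (ht : WF .seq t) (h : Eqv D ok (· = .tau) t (p.subst x t)) :
    Eqv D ok (· = .tau) (.con C) t := by
  have hp : WF .grd p := (wf_of_subst_con p).1 (body_grd hb)
  have nC : (.con C : Tm H L K) ≠ .nil := by simp
  obtain ⟨hn, hR⟩ := (eqv_seq ht (hp.seq_of_grd.subst ht)).1 h
  have ht0 : t ≠ .nil := by
    intro h0
    have h1 := hn.1 h0
    cases p with
    | var y => exact not_wf_grd_var hp
    | nil => exact hp0 rfl
    | _ => simp [Tm.subst] at h1
  have hsafe : ¬ TauSteps D p (.var x) := by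
    intro h1
    rcases h1.cases_head with rfl | ⟨p', h2, h3⟩
    · exact not_wf_grd_var hp
    · have h4 := TauSteps.subst h3 x (.con C)
      simp only [Tm.subst, if_true] at h4
      exact hog (.head' (.con hb (h2.subst x _)) h4)
  have hbis : ∀ G, WF .seq G →
      Bisim (Tr D ok) (· = .tau) (G.subst x (.con C)) (G.subst x t) := by
    intro G hG
    have h1 := bisim_subst_of_safe hb hp hp0 hsafe ht0 hR (hG.subst (x := x) hp.seq_of_grd)
      (not_tauSteps_subst_var hp hsafe hG)
    rw [subst_subst_self, subst_subst_self] at h1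
    exact ((bisim_subst nC (by rwa [Ne, subst_eq_nil nC]) (.of_moves_iff fun _ _ => tr_con hb)
      hG).trans h1).trans (bisim_subst ht0 (by rwa [Ne, subst_eq_nil ht0]) hR hG).symm
  refine (eqv_seq (.con C) ht).2 ⟨by simp [ht0], RBisim.trans ?_ hR.symm⟩
  refine RBisim.trans (.of_moves_iff fun _ _ => tr_con hb) ⟨?_, ?_⟩
  · exact root_subst_grd nC ht0 hbis hp
  · exact root_subst_grd ht0 nC (fun G hG => (hbis G hG).symm) hp

/-- Soundness of `B`: the inner silent move loses none of the moves of `p + q`. -/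
theorem eqv_branching (hok : ok .tau) {μ : Act H L} {p q : Tm H L K} (hp : WF .grd p)
    (hq : WF .grd q) :
    Eqv D ok (· = .tau) (.pre μ (.sum (.pre .tau (.sum p q)) p)) (.pre μ (.sum p q)) := by
  have hbis : Bisim (Tr D ok) (· = .tau) (.sum (.pre .tau (.sum p q)) p) (.sum p q) := by
    let S : Tm H L K → Tm H L K → Prop := fun s t =>
      s = .sum (.pre .tau (.sum p q)) p ∧ t = .sum p q ∨ s = t
    have hrefl : ∀ m, PostRel S m m := PostRel.refl fun _ => .inr rfl
    refine ⟨S, ?_, ?_, .inl ⟨rfl, rfl⟩⟩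
    · rintro s t (⟨rfl, rfl⟩ | rfl) ℓ m hm
      · rcases tr_sum.1 hm with h | h
        · obtain ⟨-, rfl, rfl⟩ := tr_pre.1 h
          exact .inl ⟨rfl, _, _, rfl, .refl, .inl ⟨rfl, rfl⟩, .inr rfl⟩
        · exact .inr ⟨_, m, .refl, tr_sum.2 (.inl h), .inl ⟨rfl, rfl⟩, hrefl m⟩
      · exact .inr ⟨_, m, .refl, hm, .inr rfl, hrefl m⟩
    · rintro t s (⟨rfl, rfl⟩ | rfl) ℓ m hm
      · refine .inr ⟨_, m, quiet_of_tr ?_, hm, .inr rfl, (hrefl m).flip⟩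
        exact tr_sum.2 (.inl (tr_pre.2 ⟨hok, rfl, rfl⟩))
      · exact .inr ⟨_, m, .refl, hm, .inr rfl, (hrefl m).flip⟩
  have h1 : WF .grd (.sum (.pre .tau (.sum p q)) p) := .sum (.pre (.ofGrd (.sum hp hq))) hp
  refine (eqv_seq (wf_seq_pre.2 h1.seq_of_grd) (wf_seq_pre.2 (.ofGrd (.sum hp hq)))).2
    ⟨by simp, root_pre ?_, root_pre ?_⟩
  · exact postRel_post (by simp) fun _ _ => hbis
  · exact postRel_post (by simp) fun _ _ => hbis.symm

end SilentLaws

/-! ### The laws for unguarded recursion -/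

section Unguarded

variable {H L K : Type*} {D : Env H L K} {ok : Act H L → Prop}

theorem tr_tau_pre {p : Tm H L K} (hok : ok .tau) (hp : p ≠ .nil) :
    Tr D ok (.pre .tau p) .tau (some p) :=
  tr_pre.2 ⟨hok, rfl, (post_of_ne hp).symm⟩

theorem of_tr_tau_pre {p : Tm H L K} {ℓ : Act H L} {m : Option (Tm H L K)} (hp : p ≠ .nil)
    (h : Tr D ok (.pre .tau p) ℓ m) : ℓ = .tau ∧ m = some p := by
  obtain ⟨-, h1, h2⟩ := tr_pre.1 h
  exact ⟨h1, h2.trans (post_of_ne hp)⟩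

theorem PostRel.of {P : Type*} {R : P → P → Prop} {a b : P} (h : R a b) :
    PostRel R (some a) (some b) :=
  .inr ⟨a, b, rfl, rfl, h⟩

/-- Soundness of `U1`: the silent loop of `A` may be ignored, so `A` is branching bisimilar to the
state `p{B/x} + 0` that `B` reaches by its initial silent move. -/
theorem rbisim_U1 (hok : ok .tau) {x : ℕ} {p : Tm H L K} {A B : Const K}
    (hA : D.body A = some ((Tm.sum (.pre .tau (.var x)) p).subst x (.con A)))
    (hB : D.body B = some ((Tm.sum (.pre .tau (.sum p .nil)) p).subst x (.con B))) :
    RBisim (Tr D ok) (· = .tau) (.con A : Tm H L K) (.con B) := by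
  have hp := (wf_grd_sum.1 ((wf_of_subst_con _).1 (body_grd hA))).2
  simp only [Tm.subst, if_true] at hA hB
  set b : Tm H L K := .sum (p.subst x (.con B)) .nil with hb
  have nb : b ≠ .nil := by simp [hb]
  have nc : ∀ C : Const K, (.con C : Tm H L K) ≠ .nil := by simp
  let S : Tm H L K → Tm H L K → Prop := fun s t =>
    (∃ G, WF .seq G ∧ s = G.subst x (.con A) ∧ t = G.subst x (.con B)) ∨ s = .con A ∧ t = b
  have hctx : ∀ G, WF .seq G → S (G.subst x (.con A)) (G.subst x (.con B)) :=
    fun G hG => .inl ⟨G, hG, rfl, rfl⟩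
  have hAb : S (.con A) b := .inr ⟨rfl, rfl⟩
  have hp1 := root_subst_grd (D := D) (ok := ok) (nc A) (nc B) hctx hp
  have hp2 := root_subst_grd (S := flip S) (D := D) (ok := ok) (nc B) (nc A) hctx hp
  refine rbisim_of_contexts hctx ?_ ?_ ?_
  · rintro s t (h | ⟨rfl, rfl⟩)
    · exact .inl h
    · refine .inr ⟨fun ℓ m hm => ?_, fun ℓ m hm => ?_⟩
      · rcases tr_sum.1 ((tr_con hA).1 hm) with h | h
        · obtain ⟨rfl, rfl⟩ := of_tr_tau_pre (nc A) h
          exact .inl ⟨rfl, _, _, rfl, .refl, hAb, hAb⟩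
        · obtain ⟨m', h1, h2⟩ := hp1 ℓ m h
          exact .inr ⟨b, m', .refl, tr_sum.2 (.inl h1), hAb, h2⟩
      · obtain ⟨m', h1, h2⟩ := hp2 ℓ m ((tr_sum.1 hm).resolve_right (by simp [tr_nil]))
        exact .inr ⟨_, m', .refl, (tr_con hA).2 (tr_sum.2 (.inr h1)), hAb, h2⟩
  · intro ℓ m hm
    rcases tr_sum.1 ((tr_con hA).1 hm) with h | h
    · obtain ⟨rfl, rfl⟩ := of_tr_tau_pre (nc A) h
      exact ⟨_, (tr_con hB).2 (tr_sum.2 (.inl (tr_tau_pre hok nb))), .of hAb⟩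
    · obtain ⟨m', h1, h2⟩ := hp1 ℓ m h
      exact ⟨m', (tr_con hB).2 (tr_sum.2 (.inr h1)), h2⟩
  · intro ℓ m hm
    rcases tr_sum.1 ((tr_con hB).1 hm) with h | h
    · obtain ⟨rfl, rfl⟩ := of_tr_tau_pre nb h
      exact ⟨_, (tr_con hA).2 (tr_sum.2 (.inl (tr_tau_pre hok (nc A)))), .of hAb⟩
    · obtain ⟨m', h1, h2⟩ := hp2 ℓ m h
      exact ⟨m', (tr_con hA).2 (tr_sum.2 (.inr h1)), h2⟩

/-- Soundness of `U2`: `A` and the state `τ.A + p{A/x}` lie on a silent cycle, so both have all the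
moves of `p{B/x} + r{B/x}` at their disposal. -/
theorem rbisim_U2 (hok : ok .tau) {x : ℕ} {p r : Tm H L K} {A B : Const K}
    (hA : D.body A = some
      ((Tm.sum (.pre .tau (.sum (.pre .tau (.var x)) p)) r).subst x (.con A)))
    (hB : D.body B = some ((Tm.sum (.pre .tau (.sum p r)) r).subst x (.con B))) :
    RBisim (Tr D ok) (· = .tau) (.con A : Tm H L K) (.con B) := by
  obtain ⟨hpr, hr⟩ := wf_grd_sum.1 ((wf_of_subst_con _).1 (body_grd hB))
  have hp := (wf_seq_sum.1 (wf_grd_pre.1 hpr)).1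
  simp only [Tm.subst, if_true] at hA hB
  set a : Tm H L K := .sum (.pre .tau (.con A)) (p.subst x (.con A)) with ha
  set b : Tm H L K := .sum (p.subst x (.con B)) (r.subst x (.con B)) with hb
  have na : a ≠ .nil := by simp [ha]
  have nb : b ≠ .nil := by simp [hb]
  have nc : ∀ C : Const K, (.con C : Tm H L K) ≠ .nil := by simp
  let S : Tm H L K → Tm H L K → Prop := fun s t =>
    (∃ G, WF .seq G ∧ s = G.subst x (.con A) ∧ t = G.subst x (.con B)) ∨
      (s = .con A ∨ s = a) ∧ t = b
  have hctx : ∀ G, WF .seq G → S (G.subst x (.con A)) (G.subst x (.con B)) :=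
    fun G hG => .inl ⟨G, hG, rfl, rfl⟩
  have hAb : S (.con A) b := .inr ⟨.inl rfl, rfl⟩
  have hab : S a b := .inr ⟨.inr rfl, rfl⟩
  have hp1 := root_subst_grd (D := D) (ok := ok) (nc A) (nc B) hctx hp
  have hp2 := root_subst_grd (S := flip S) (D := D) (ok := ok) (nc B) (nc A) hctx hp
  have hr1 := root_subst_grd (D := D) (ok := ok) (nc A) (nc B) hctx hr
  have hr2 := root_subst_grd (S := flip S) (D := D) (ok := ok) (nc B) (nc A) hctx hr
  have tAa : Tr D ok (.con A) .tau (some a) :=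
    (tr_con hA).2 (tr_sum.2 (.inl (tr_tau_pre hok na)))
  have taA : Tr D ok a .tau (some (.con A)) := tr_sum.2 (.inl (tr_tau_pre hok (nc A)))
  refine rbisim_of_contexts hctx ?_ ?_ ?_
  · rintro s t (h | ⟨hs, rfl⟩)
    · exact .inl h
    have qA : Quiet (Tr D ok) (· = .tau) s (.con A) := by
      rcases hs with rfl | rfl
      exacts [.refl, quiet_of_tr taA]
    have qa : Quiet (Tr D ok) (· = .tau) s a := qA.trans (quiet_of_tr tAa)
    refine .inr ⟨?_, fun ℓ m hm => ?_⟩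
    · rcases hs with rfl | rfl
      · intro ℓ m hm
        rcases tr_sum.1 ((tr_con hA).1 hm) with h | h
        · obtain ⟨rfl, rfl⟩ := of_tr_tau_pre na h
          exact .inl ⟨rfl, _, _, rfl, .refl, hAb, hab⟩
        · obtain ⟨m', h1, h2⟩ := hr1 ℓ m h
          exact .inr ⟨b, m', .refl, tr_sum.2 (.inr h1), hAb, h2⟩
      · intro ℓ m hm
        rcases tr_sum.1 hm with h | h
        · obtain ⟨rfl, rfl⟩ := of_tr_tau_pre (nc A) h
          exact .inl ⟨rfl, _, _, rfl, .refl, hab, hAb⟩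
        · obtain ⟨m', h1, h2⟩ := hp1 ℓ m h
          exact .inr ⟨b, m', .refl, tr_sum.2 (.inl h1), hab, h2⟩
    · rcases tr_sum.1 hm with h | h
      · obtain ⟨m', h1, h2⟩ := hp2 ℓ m h
        exact .inr ⟨a, m', qa, tr_sum.2 (.inr h1), hab, h2⟩
      · obtain ⟨m', h1, h2⟩ := hr2 ℓ m h
        exact .inr ⟨_, m', qA, (tr_con hA).2 (tr_sum.2 (.inr h1)), hAb, h2⟩
  · intro ℓ m hm
    rcases tr_sum.1 ((tr_con hA).1 hm) with h | h
    · obtain ⟨rfl, rfl⟩ := of_tr_tau_pre na h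
      exact ⟨_, (tr_con hB).2 (tr_sum.2 (.inl (tr_tau_pre hok nb))), .of hab⟩
    · obtain ⟨m', h1, h2⟩ := hr1 ℓ m h
      exact ⟨m', (tr_con hB).2 (tr_sum.2 (.inr h1)), h2⟩
  · intro ℓ m hm
    rcases tr_sum.1 ((tr_con hB).1 hm) with h | h
    · obtain ⟨rfl, rfl⟩ := of_tr_tau_pre nb h
      exact ⟨_, tAa, .of hab⟩
    · obtain ⟨m', h1, h2⟩ := hr2 ℓ m h
      exact ⟨m', (tr_con hA).2 (tr_sum.2 (.inr h1)), h2⟩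

/-- Soundness of `U3`: as `x` is unguarded in `q`, the states `A`, `τ.q{A/x} + p{A/x}` and `q{A/x}`
lie on a silent cycle, and the last two are branching bisimilar to `q{B/x} + p{B/x}`. -/
theorem rbisim_U3 (hok : ok .tau) {x : ℕ} {p q r : Tm H L K} {A B : Const K}
    (hq : WF .grd q) (hx : q.Unguarded x)
    (hA : D.body A = some ((Tm.sum (.pre .tau (.sum (.pre .tau q) p)) r).subst x (.con A)))
    (hB : D.body B = some ((Tm.sum (.pre .tau (.sum q p)) r).subst x (.con B))) :
    RBisim (Tr D ok) (· = .tau) (.con A : Tm H L K) (.con B) := by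
  obtain ⟨hqp, hr⟩ := wf_grd_sum.1 ((wf_of_subst_con _).1 (body_grd hB))
  have hp := (wf_seq_sum.1 (wf_grd_pre.1 hqp)).2
  have hq0 : q ≠ .nil := by rintro rfl; exact hx
  have nc : ∀ C : Const K, (.con C : Tm H L K) ≠ .nil := by simp
  have qqA : Quiet (Tr D ok) (· = .tau) (q.subst x (.con A)) (.con A) :=
    quiet_of_unguarded hok hq.seq_of_grd hx (nc A)
  simp only [Tm.subst] at hA hB
  set c : Tm H L K := q.subst x (.con A) with hc
  set a : Tm H L K := .sum (.pre .tau c) (p.subst x (.con A)) with ha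
  set b : Tm H L K := .sum (q.subst x (.con B)) (p.subst x (.con B)) with hb
  have n_c : c ≠ .nil := by rwa [hc, Ne, subst_eq_nil (nc A)]
  have na : a ≠ .nil := by simp [ha]
  have nb : b ≠ .nil := by simp [hb]
  let S : Tm H L K → Tm H L K → Prop := fun s t =>
    (∃ G, WF .seq G ∧ s = G.subst x (.con A) ∧ t = G.subst x (.con B)) ∨ (s = c ∨ s = a) ∧ t = b
  have hctx : ∀ G, WF .seq G → S (G.subst x (.con A)) (G.subst x (.con B)) :=
    fun G hG => .inl ⟨G, hG, rfl, rfl⟩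
  have hcb : S c b := .inr ⟨.inl rfl, rfl⟩
  have hab : S a b := .inr ⟨.inr rfl, rfl⟩
  have hp1 := root_subst_grd (D := D) (ok := ok) (nc A) (nc B) hctx hp
  have hp2 := root_subst_grd (S := flip S) (D := D) (ok := ok) (nc B) (nc A) hctx hp
  have hq1 := root_subst_grd (D := D) (ok := ok) (nc A) (nc B) hctx hq
  have hq2 := root_subst_grd (S := flip S) (D := D) (ok := ok) (nc B) (nc A) hctx hq
  have hr1 := root_subst_grd (D := D) (ok := ok) (nc A) (nc B) hctx hr
  have hr2 := root_subst_grd (S := flip S) (D := D) (ok := ok) (nc B) (nc A) hctx hr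
  have tAa : Tr D ok (.con A) .tau (some a) :=
    (tr_con hA).2 (tr_sum.2 (.inl (tr_tau_pre hok na)))
  have tac : Tr D ok a .tau (some c) := tr_sum.2 (.inl (tr_tau_pre hok n_c))
  refine rbisim_of_contexts hctx ?_ ?_ ?_
  · rintro s t (h | ⟨hs, rfl⟩)
    · exact .inl h
    have qc : Quiet (Tr D ok) (· = .tau) s c := by
      rcases hs with rfl | rfl
      exacts [.refl, quiet_of_tr tac]
    have qa : Quiet (Tr D ok) (· = .tau) s a := (qc.trans qqA).trans (quiet_of_tr tAa)
    refine .inr ⟨?_, fun ℓ m hm => ?_⟩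
    · rcases hs with rfl | rfl
      · intro ℓ m hm
        obtain ⟨m', h1, h2⟩ := hq1 ℓ m hm
        exact .inr ⟨b, m', .refl, tr_sum.2 (.inl h1), hcb, h2⟩
      · intro ℓ m hm
        rcases tr_sum.1 hm with h | h
        · obtain ⟨rfl, rfl⟩ := of_tr_tau_pre n_c h
          exact .inl ⟨rfl, _, _, rfl, .refl, hab, hcb⟩
        · obtain ⟨m', h1, h2⟩ := hp1 ℓ m h
          exact .inr ⟨b, m', .refl, tr_sum.2 (.inr h1), hab, h2⟩
    · rcases tr_sum.1 hm with h | h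
      · obtain ⟨m', h1, h2⟩ := hq2 ℓ m h
        exact .inr ⟨c, m', qc, h1, hcb, h2⟩
      · obtain ⟨m', h1, h2⟩ := hp2 ℓ m h
        exact .inr ⟨a, m', qa, tr_sum.2 (.inr h1), hab, h2⟩
  · intro ℓ m hm
    rcases tr_sum.1 ((tr_con hA).1 hm) with h | h
    · obtain ⟨rfl, rfl⟩ := of_tr_tau_pre na h
      exact ⟨_, (tr_con hB).2 (tr_sum.2 (.inl (tr_tau_pre hok nb))), .of hab⟩
    · obtain ⟨m', h1, h2⟩ := hr1 ℓ m h
      exact ⟨m', (tr_con hB).2 (tr_sum.2 (.inr h1)), h2⟩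
  · intro ℓ m hm
    rcases tr_sum.1 ((tr_con hB).1 hm) with h | h
    · obtain ⟨rfl, rfl⟩ := of_tr_tau_pre nb h
      exact ⟨_, tAa, .of hab⟩
    · obtain ⟨m', h1, h2⟩ := hr2 ℓ m h
      exact ⟨m', (tr_con hA).2 (tr_sum.2 (.inr h1)), h2⟩

/-- Soundness of `U4`: `A` and its two silent successors lie on silent cycles, so each of these
successors can silently reach the other one and offer the moves of both. -/
theorem rbisim_U4 (hok : ok .tau) {x : ℕ} {p q r : Tm H L K} {A B : Const K}
    (hA : D.body A = some
      ((Tm.sum (.sum (.pre .tau (.sum (.pre .tau (.var x)) p))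
        (.pre .tau (.sum (.pre .tau (.var x)) q))) r).subst x (.con A)))
    (hB : D.body B = some
      ((Tm.sum (.pre .tau (.sum (.sum (.pre .tau (.var x)) p) q)) r).subst x (.con B))) :
    RBisim (Tr D ok) (· = .tau) (.con A : Tm H L K) (.con B) := by
  obtain ⟨hqp, hr⟩ := wf_grd_sum.1 ((wf_of_subst_con _).1 (body_grd hB))
  obtain ⟨hp, hq⟩ := wf_seq_sum.1 (wf_grd_pre.1 hqp)
  have hp := (wf_grd_sum.1 hp).2
  have nc : ∀ C : Const K, (.con C : Tm H L K) ≠ .nil := by simp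
  simp only [Tm.subst, if_true] at hA hB
  set a₁ : Tm H L K := .sum (.pre .tau (.con A)) (p.subst x (.con A)) with ha₁
  set a₂ : Tm H L K := .sum (.pre .tau (.con A)) (q.subst x (.con A)) with ha₂
  set b : Tm H L K :=
    .sum (.sum (.pre .tau (.con B)) (p.subst x (.con B))) (q.subst x (.con B)) with hb
  have na₁ : a₁ ≠ .nil := by simp [ha₁]
  have na₂ : a₂ ≠ .nil := by simp [ha₂]
  have nb : b ≠ .nil := by simp [hb]
  let S : Tm H L K → Tm H L K → Prop := fun s t =>
    (∃ G, WF .seq G ∧ s = G.subst x (.con A) ∧ t = G.subst x (.con B)) ∨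
      (s = a₁ ∨ s = a₂) ∧ t = b
  have hctx : ∀ G, WF .seq G → S (G.subst x (.con A)) (G.subst x (.con B)) :=
    fun G hG => .inl ⟨G, hG, rfl, rfl⟩
  have hAB : S (.con A) (.con B) := by simpa [Tm.subst] using hctx (.var x) (.var x)
  have h1b : S a₁ b := .inr ⟨.inl rfl, rfl⟩
  have h2b : S a₂ b := .inr ⟨.inr rfl, rfl⟩
  have hp1 := root_subst_grd (D := D) (ok := ok) (nc A) (nc B) hctx hp
  have hp2 := root_subst_grd (S := flip S) (D := D) (ok := ok) (nc B) (nc A) hctx hp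
  have hq1 := root_subst_grd (D := D) (ok := ok) (nc A) (nc B) hctx hq
  have hq2 := root_subst_grd (S := flip S) (D := D) (ok := ok) (nc B) (nc A) hctx hq
  have hr1 := root_subst_grd (D := D) (ok := ok) (nc A) (nc B) hctx hr
  have hr2 := root_subst_grd (S := flip S) (D := D) (ok := ok) (nc B) (nc A) hctx hr
  have tA1 : Tr D ok (.con A) .tau (some a₁) :=
    (tr_con hA).2 (tr_sum.2 (.inl (tr_sum.2 (.inl (tr_tau_pre hok na₁)))))
  have tA2 : Tr D ok (.con A) .tau (some a₂) :=
    (tr_con hA).2 (tr_sum.2 (.inl (tr_sum.2 (.inr (tr_tau_pre hok na₂)))))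
  have tBb : Tr D ok (.con B) .tau (some b) :=
    (tr_con hB).2 (tr_sum.2 (.inl (tr_tau_pre hok nb)))
  have tbB : Tr D ok b .tau (some (.con B)) :=
    tr_sum.2 (.inl (tr_sum.2 (.inl (tr_tau_pre hok (nc B)))))
  refine rbisim_of_contexts hctx ?_ ?_ ?_
  · rintro s t (h | ⟨hs, rfl⟩)
    · exact .inl h
    have tsA : Tr D ok s .tau (some (.con A)) := by
      rcases hs with rfl | rfl <;> exact tr_sum.2 (.inl (tr_tau_pre hok (nc A)))
    have hsb : S s b := .inr ⟨hs, rfl⟩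
    refine .inr ⟨?_, fun ℓ m hm => ?_⟩
    · rcases hs with rfl | rfl
      · intro ℓ m hm
        rcases tr_sum.1 hm with h | h
        · obtain ⟨rfl, rfl⟩ := of_tr_tau_pre (nc A) h
          exact .inr ⟨b, _, .refl, tbB, hsb, .of hAB⟩
        · obtain ⟨m', h1, h2⟩ := hp1 ℓ m h
          exact .inr ⟨b, m', .refl, tr_sum.2 (.inl (tr_sum.2 (.inr h1))), hsb, h2⟩
      · intro ℓ m hm
        rcases tr_sum.1 hm with h | h
        · obtain ⟨rfl, rfl⟩ := of_tr_tau_pre (nc A) h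
          exact .inr ⟨b, _, .refl, tbB, hsb, .of hAB⟩
        · obtain ⟨m', h1, h2⟩ := hq1 ℓ m h
          exact .inr ⟨b, m', .refl, tr_sum.2 (.inr h1), hsb, h2⟩
    · have q1 : Quiet (Tr D ok) (· = .tau) s a₁ := (quiet_of_tr tsA).trans (quiet_of_tr tA1)
      have q2 : Quiet (Tr D ok) (· = .tau) s a₂ := (quiet_of_tr tsA).trans (quiet_of_tr tA2)
      rcases tr_sum.1 hm with h | h
      · rcases tr_sum.1 h with h | h
        · obtain ⟨rfl, rfl⟩ := of_tr_tau_pre (nc B) h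
          exact .inr ⟨s, _, .refl, tsA, hsb, .of hAB⟩
        · obtain ⟨m', h1, h2⟩ := hp2 ℓ m h
          exact .inr ⟨a₁, m', q1, tr_sum.2 (.inr h1), h1b, h2⟩
      · obtain ⟨m', h1, h2⟩ := hq2 ℓ m h
        exact .inr ⟨a₂, m', q2, tr_sum.2 (.inr h1), h2b, h2⟩
  · intro ℓ m hm
    rcases tr_sum.1 ((tr_con hA).1 hm) with h | h
    · rcases tr_sum.1 h with h | h
      · obtain ⟨rfl, rfl⟩ := of_tr_tau_pre na₁ h
        exact ⟨_, tBb, .of h1b⟩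
      · obtain ⟨rfl, rfl⟩ := of_tr_tau_pre na₂ h
        exact ⟨_, tBb, .of h2b⟩
    · obtain ⟨m', h1, h2⟩ := hr1 ℓ m h
      exact ⟨m', (tr_con hB).2 (tr_sum.2 (.inr h1)), h2⟩
  · intro ℓ m hm
    rcases tr_sum.1 ((tr_con hB).1 hm) with h | h
    · obtain ⟨rfl, rfl⟩ := of_tr_tau_pre nb h
      exact ⟨_, tA1, .of h1b⟩
    · obtain ⟨m', h1, h2⟩ := hr2 ℓ m h
      exact ⟨m', (tr_con hA).2 (tr_sum.2 (.inr h1)), h2⟩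

end Unguarded

/-! ### Soundness of the equational theory -/

section Soundness

variable {H L K : Type*} {D : Env H L K} {ok : Act H L → Prop} {sil : Act H L → Prop}

theorem sub_ne_nil {p : Tm H L K} {σ : ℕ → Tm H L K} (hp : WF .grd p) (h : p ≠ .nil) :
    p.sub σ ≠ .nil := by
  cases hp <;> simp_all [Tm.sub]

/-- Derivable equations hold for all sequential instances, in every subnet given by `ok`. The laws
`A1`-`A4` are sound regardless of which actions are absorbed, in particular for strong
bisimilarity. -/
theorem Deriv.sound {𝓔 : Set Law} (h𝓔 : 𝓔 ⊆ lawsA ∨ sil = (· = .tau) ∧ ok .tau)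
    {p q : Tm H L K} (h : Deriv D 𝓔 p q) :
    ∀ σ : ℕ → Tm H L K, (∀ y, WF .seq (σ y)) → Eqv D ok sil (p.sub σ) (q.sub σ) := by
  have hE : ∀ {l : Law}, l ∈ 𝓔 → l ∉ lawsA → sil = (· = .tau) ∧ ok .tau :=
    fun h1 h2 => h𝓔.resolve_left fun h3 => h2 (h3 h1)
  have hinst : ∀ {p q : Tm H L K},
      (∀ σ : ℕ → Tm H L K, (∀ y, WF .seq (σ y)) → Eqv D ok sil (p.sub σ) (q.sub σ)) →
      ∀ (x : ℕ) {t : Tm H L K}, WF .seq t → Eqv D ok sil (p.subst x t) (q.subst x t) := by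
    intro p q ih x t ht
    rw [subst_eq_sub, subst_eq_sub]
    exact ih _ (wf_single ht)
  induction h with
  | refl _ => exact fun σ _ => .refl _
  | symm _ ih => exact fun σ hσ => (ih σ hσ).symm
  | trans _ _ ih1 ih2 => exact fun σ hσ => (ih1 σ hσ).trans (ih2 σ hσ)
  | pre hp hq _ ih => exact fun σ hσ => (ih σ hσ).pre (hp.sub hσ) (hq.sub hσ)
  | sum hp hq hp' hq' _ _ ih1 ih2 =>
    exact fun σ hσ =>
      Eqv.sum (hp.sub hσ) (hq.sub hσ) (hp'.sub hσ) (hq'.sub hσ) (ih1 σ hσ) (ih2 σ hσ)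
  | par _ _ ih1 ih2 => exact fun σ hσ => (ih1 σ hσ).par (ih2 σ hσ)
  | inst x ht _ ih =>
    intro σ hσ
    rw [subst_eq_sub, subst_eq_sub, sub_sub, sub_sub]
    exact ih _ fun y => (wf_single ht y).sub hσ
  | recCong x _ hA hB ih =>
    exact fun _ _ => eqv_con_of_rbisim (rbisim_of_body (fun C => hinst ih x (.con C)) hA hB)
  | A1 _ hp hq hr =>
    intro σ hσ
    refine eqv_of_tr_iff ((WF.sum hp (.sum hq hr)).sub hσ).seq_of_grd
      ((WF.sum (.sum hp hq) hr).sub hσ).seq_of_grd (by simp [Tm.sub]) (by simp [Tm.sub])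
      fun ℓ m => ?_
    simp only [Tm.sub, tr_sum, or_assoc]
  | A2 _ hp hq =>
    intro σ hσ
    refine eqv_of_tr_iff ((WF.sum hp hq).sub hσ).seq_of_grd ((WF.sum hq hp).sub hσ).seq_of_grd
      (by simp [Tm.sub]) (by simp [Tm.sub]) fun ℓ m => ?_
    simp only [Tm.sub, tr_sum]
    exact or_comm
  | A3 _ hp h0 =>
    intro σ hσ
    refine eqv_of_tr_iff ((WF.sum hp .nil).sub hσ).seq_of_grd (hp.sub hσ).seq_of_grd
      (by simp [Tm.sub]) (sub_ne_nil hp h0) fun ℓ m => ?_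
    simp only [Tm.sub, tr_sum, tr_nil, or_false]
  | A4 _ hp h0 =>
    intro σ hσ
    refine eqv_of_tr_iff ((WF.sum hp hp).sub hσ).seq_of_grd (hp.sub hσ).seq_of_grd
      (by simp [Tm.sub]) (sub_ne_nil hp h0) fun ℓ m => ?_
    simp only [Tm.sub, tr_sum, or_self]
  | B hl hp hq =>
    intro σ hσ
    obtain ⟨rfl, hok⟩ := hE hl (by simp [lawsA])
    exact eqv_branching hok (hp.sub hσ) (hq.sub hσ)
  | R1 _ hb =>
    intro σ _
    refine eqv_of_tr_iff (.con _) (WF.sum .nil .nil).seq_of_grd (by simp [Tm.sub])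
      (by simp [Tm.sub]) fun ℓ m => ?_
    simp only [Tm.sub, tr_con hb, tr_sum, tr_nil, or_self]
  | R2 _ hb h0 =>
    intro σ _
    rw [(body_closed hb).sub_eq]
    exact eqv_of_tr_iff (.con _) (body_grd hb).seq_of_grd (by simp [Tm.sub]) h0 fun ℓ m => tr_con hb
  | @R3 C p q x hl hb h0 hog hq _ ih =>
    intro σ hσ
    obtain ⟨rfl, -⟩ := hE hl (by simp [lawsA])
    refine eqv_of_unique_solution hb h0 hog (hq.sub hσ) ?_
    have h1 := ih σ hσ
    rw [subst_eq_sub, sub_sub, sub_eq_subst_of_closed (body_closed hb)] at h1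
    simpa [single] using h1
  | U1 x hl hA hB =>
    obtain ⟨rfl, hok⟩ := hE hl (by simp [lawsA])
    exact fun _ _ => eqv_con_of_rbisim (rbisim_U1 hok hA hB)
  | U2 x hl hA hB =>
    obtain ⟨rfl, hok⟩ := hE hl (by simp [lawsA])
    exact fun _ _ => eqv_con_of_rbisim (rbisim_U2 hok hA hB)
  | U3 x hl hq hx hA hB =>
    obtain ⟨rfl, hok⟩ := hE hl (by simp [lawsA])
    exact fun _ _ => eqv_con_of_rbisim (rbisim_U3 hok hq hx hA hB)
  | U4 x hl hA hB =>
    obtain ⟨rfl, hok⟩ := hE hl (by simp [lawsA])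
    exact fun _ _ => eqv_con_of_rbisim (rbisim_U4 hok hA hB)
  | P1 =>
    intro σ _
    simp only [Eqv, Tm.sub, dec, add_assoc]
    exact Eqv.refl (.par _ (.par _ _))
  | P2 =>
    intro σ _
    simp only [Eqv, Tm.sub, dec]
    rw [add_comm]
    exact Eqv.refl (.par _ _)
  | P3 =>
    intro σ _
    simp only [Eqv, Tm.sub, dec, add_zero]
    exact Eqv.refl _

theorem Deriv.eqv {𝓔 : Set Law} (h𝓔 : 𝓔 ⊆ lawsA ∨ sil = (· = .tau) ∧ ok .tau)
    {p q : Tm H L K} (h : Deriv D 𝓔 p q) : Eqv D ok sil p q := by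
  have hvar : ∀ p : Tm H L K, p.sub .var = p := by
    intro p
    induction p <;> simp_all [Tm.sub]
  simpa only [hvar] using h.sound h𝓔 .var .var

/-- The outermost operator is one of those of guarded terms. -/
def Tm.GuardedTop : Tm H L K → Prop
  | .nil => True
  | .pre _ _ => True
  | .sum _ _ => True
  | .con _ => False
  | .par _ _ => False
  | .var _ => False

theorem WF.guardedTop {p : Tm H L K} (h : WF .grd p) : p.GuardedTop := by
  cases h <;> trivial

theorem WF.grd_of_guardedTop {p : Tm H L K} (h : WF .par p) (ht : p.GuardedTop) : WF .grd p := by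
  cases h with
  | par _ _ => exact ht.elim
  | ofSeq h =>
    cases h with
    | ofGrd h => exact h
    | con _ => exact ht.elim
    | var _ => exact ht.elim

theorem guardedTop_subst {p t : Tm H L K} {x : ℕ} :
    (p.subst x t).GuardedTop ↔ p.GuardedTop ∨ p = .var x ∧ t.GuardedTop := by
  cases p with
  | var y => by_cases hy : y = x <;> simp [Tm.subst, hy, Tm.GuardedTop]
  | _ => simp [Tm.subst, Tm.GuardedTop]

theorem subst_eq_var {p t : Tm H L K} {x y : ℕ} :
    p.subst x t = .var y ↔ p = .var y ∧ y ≠ x ∨ p = .var x ∧ t = .var y := by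
  cases p with
  | var z =>
    by_cases hz : z = x
    · subst hz
      simp only [Tm.subst, if_true, Tm.var.injEq, true_and]
      exact ⟨.inr, fun h => h.elim (fun h => absurd h.1.symm h.2) id⟩
    · simp only [Tm.subst, hz, if_false, Tm.var.injEq, false_and, or_false]
      exact ⟨fun h => ⟨h, h ▸ hz⟩, And.left⟩
  | _ => simp [Tm.subst]

/-- The laws `A1`-`A4` do not identify guarded terms with terms that are not guarded. The variables
have to be followed too, because guarded terms may be substituted for them. -/
theorem Deriv.guardedTop_iff {p q : Tm H L K} (h : Deriv D lawsA p q) :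
    WF .par p ∧ WF .par q ∧ (p.GuardedTop ↔ q.GuardedTop) ∧ ∀ y, p = .var y ↔ q = .var y := by
  have hgrd : ∀ {p q : Tm H L K}, WF .grd p → WF .grd q →
      WF .par p ∧ WF .par q ∧ (p.GuardedTop ↔ q.GuardedTop) ∧ ∀ y, p = .var y ↔ q = .var y := by
    refine fun hp hq => ⟨hp.par_of_grd, hq.par_of_grd, iff_of_true hp.guardedTop hq.guardedTop,
      fun y => iff_of_false ?_ ?_⟩
    · rintro rfl; exact not_wf_grd_var hp
    · rintro rfl; exact not_wf_grd_var hq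
  induction h with
  | refl h => exact ⟨h, h, .rfl, fun _ => .rfl⟩
  | symm _ ih => exact ⟨ih.2.1, ih.1, ih.2.2.1.symm, fun y => (ih.2.2.2 y).symm⟩
  | trans _ _ ih1 ih2 =>
    exact ⟨ih1.1, ih2.2.1, ih1.2.2.1.trans ih2.2.2.1, fun y => (ih1.2.2.2 y).trans (ih2.2.2.2 y)⟩
  | pre hp hq _ _ => exact hgrd (.pre hp) (.pre hq)
  | sum hp hq hp' hq' _ _ _ _ => exact hgrd (.sum hp hq) (.sum hp' hq')
  | par _ _ ih1 ih2 =>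
    exact ⟨.par ih1.1 ih2.1, .par ih1.2.1 ih2.2.1, .rfl, fun y => by simp⟩
  | inst x ht _ ih =>
    refine ⟨ih.1.subst ht, ih.2.1.subst ht, ?_, fun y => ?_⟩
    · rw [guardedTop_subst, guardedTop_subst, ih.2.2.1, ih.2.2.2]
    · rw [subst_eq_var, subst_eq_var, ih.2.2.2, ih.2.2.2]
  | recCong => exact ⟨.ofSeq (.con _), .ofSeq (.con _), .rfl, fun y => by simp⟩
  | A1 _ hp hq hr => exact hgrd (.sum hp (.sum hq hr)) (.sum (.sum hp hq) hr)
  | A2 _ hp hq => exact hgrd (.sum hp hq) (.sum hq hp)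
  | A3 _ hp _ => exact hgrd (.sum hp .nil) hp
  | A4 _ hp _ => exact hgrd (.sum hp hp) hp
  | B hl => exact absurd hl (by simp [lawsA])
  | R1 hl => exact absurd hl (by simp [lawsA])
  | R2 hl => exact absurd hl (by simp [lawsA])
  | R3 _ hl => exact absurd hl (by simp [lawsA])
  | U1 _ hl => exact absurd hl (by simp [lawsA])
  | U2 _ hl => exact absurd hl (by simp [lawsA])
  | U3 _ hl => exact absurd hl (by simp [lawsA])
  | U4 _ hl => exact absurd hl (by simp [lawsA])
  | P1 hl => exact absurd hl (by simp [lawsA])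
  | P2 hl => exact absurd hl (by simp [lawsA])
  | P3 hl => exact absurd hl (by simp [lawsA])

theorem Deriv.grd_of_grd {p q : Tm H L K} (h : Deriv D lawsA p q) (hp : WF .grd p) : WF .grd q :=
  h.guardedTop_iff.2.1.grd_of_guardedTop (h.guardedTop_iff.2.2.1.1 hp.guardedTop)

end Soundness

/-! ### The net semantics agrees with the operational one -/

section NetSemantics

variable {H L K : Type*} {D : Env H L K}

/-- The net `N` represents the operational semantics, except that the constants in `I` are left
without transitions. -/
structure Represents (D : Env H L K) (I : Set (Const K)) (N : Net (Tm H L K) (Act H L)) : Prop where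
  wf : ∀ s ∈ N.places, WF .seq s
  sound : ∀ s μ m, (s, μ, m) ∈ N.trans → s ∈ N.places ∧ ∃ s', Step D s μ s' ∧ m = post s'
  complete : ∀ s ∈ N.places, (∀ C ∈ I, s ≠ .con C) → ∀ μ s', Step D s μ s' →
    (s, μ, post s') ∈ N.trans
  closed : ∀ s μ s', (s, μ, some s') ∈ N.trans → s' ∈ N.places

theorem Represents.union {I : Set (Const K)} {N M : Net (Tm H L K) (Act H L)}
    (hN : Represents D I N) (hM : Represents D I M) : Represents D I (N.union M) where
  wf s := by
    rintro (h | h)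
    exacts [hN.wf s h, hM.wf s h]
  sound s μ m := by
    rintro (h | h)
    exacts [(hN.sound s μ m h).imp .inl id, (hM.sound s μ m h).imp .inr id]
  complete s := by
    rintro (h | h) hI μ s' hs
    exacts [.inl (hN.complete s h hI μ s' hs), .inr (hM.complete s h hI μ s' hs)]
  closed s μ s' := by
    rintro (h | h)
    exacts [.inl (hN.closed s μ s' h), .inr (hM.closed s μ s' h)]

theorem Represents.keep {I : Set (Const K)} {N : Net (Tm H L K) (Act H L)}
    (hN : Represents D I N) (p : Tm H L K) : Represents D I (N.keep p) := by
  unfold Net.keep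
  split_ifs with hp
  · exact hN
  refine ⟨fun s h => hN.wf s h.1, fun s μ m h => ?_, fun s h hI μ s' hs => ?_, fun s μ s' h => ?_⟩
  · exact ⟨⟨(hN.sound s μ m h.1).1, h.2⟩, (hN.sound s μ m h.1).2⟩
  · exact ⟨hN.complete s h.1 hI μ s' hs, h.2⟩
  · refine ⟨hN.closed s μ s' h.1, ?_⟩
    rintro rfl
    exact hp ⟨_, h.1, rfl⟩

/-- A target of a transition is never removed. -/
theorem mem_keep_places {I : Set (Const K)} {N : Net (Tm H L K) (Act H L)}
    (hN : Represents D I N) {p s s' : Tm H L K} {μ : Act H L} (h : (s, μ, some s') ∈ N.trans) :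
    s' ∈ (N.keep p).places := by
  unfold Net.keep
  split_ifs with hp
  · exact hN.closed s μ s' h
  · refine ⟨hN.closed s μ s' h, ?_⟩
    rintro rfl
    exact hp ⟨_, h, rfl⟩

/-- Adding a place `s` together with its moves, the targets of which are places already. If `s` is a
constant, it no longer counts among the constants without transitions. -/
theorem Represents.insert {I J : Set (Const K)} {N : Net (Tm H L K) (Act H L)}
    (hN : Represents D J N) {s : Tm H L K} (hJ : ∀ C ∈ J, C ∈ I ∨ s = .con C) (hs : WF .seq s)
    {T : Set (Tm H L K × Act H L × Option (Tm H L K))}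
    (hT : ∀ t μ m, (t, μ, m) ∈ T ↔ t = s ∧ ∃ s', Step D s μ s' ∧ m = post s')
    (hp : ∀ μ s', Step D s μ s' → s' ≠ .nil → s' ∈ N.places) :
    Represents D I ⟨{s} ∪ N.places, T ∪ N.trans⟩ where
  wf t := by
    rintro (rfl | h)
    exacts [hs, hN.wf t h]
  sound t μ m := by
    rintro (h | h)
    · obtain ⟨rfl, h1⟩ := (hT t μ m).1 h
      exact ⟨.inl rfl, h1⟩
    · exact (hN.sound t μ m h).imp .inr id
  complete t ht hI μ s' hst := by
    by_cases h : t = s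
    · subst h
      exact .inl ((hT t μ _).2 ⟨rfl, s', hst, rfl⟩)
    · refine .inr (hN.complete t (ht.resolve_left h) (fun C hC => ?_) μ s' hst)
      rcases hJ C hC with h1 | rfl
      exacts [hI C h1, h]
  closed t μ s' := by
    rintro (h | h)
    · obtain ⟨rfl, s'', h1, h2⟩ := (hT t μ _).1 h
      obtain ⟨h3, rfl⟩ := post_eq_some.1 h2.symm
      exact .inr (hp μ _ h1 h3)
    · exact .inr (hN.closed t μ s' h)

theorem Represents.mem_trans_iff {I : Set (Const K)} {N : Net (Tm H L K) (Act H L)}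
    (hN : Represents D I N) {p : Tm H L K} (hp : WF .grd p) (h : p ≠ .nil → p ∈ N.places)
    {μ : Act H L} {m : Option (Tm H L K)} :
    (p, μ, m) ∈ N.trans ↔ ∃ s', Step D p μ s' ∧ m = post s' := by
  refine ⟨fun h1 => (hN.sound p μ m h1).2, ?_⟩
  rintro ⟨s', h1, rfl⟩
  refine hN.complete p (h ?_) (fun C _ => ?_) μ s' h1
  · rintro rfl
    exact not_step_nil h1
  · rintro rfl
    exact not_wf_grd_con hp

/-- `⟦p⟧_I` represents the operational semantics, and its initial marking consists of places. -/
theorem net_represents [Finite K] (I : Set (Const K)) (p : Tm H L K) (hp : WF .par p) :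
    Represents D I (net D I p) ∧ ∀ s ∈ dec p, s ∈ (net D I p).places := by
  have hself : ∀ {p : Tm H L K} {N : Net (Tm H L K) (Act H L)}, WF .seq p →
      (∀ s ∈ dec p, s ∈ N.places) → p ≠ .nil → p ∈ N.places := by
    intro p N hp h h0
    exact h p (by simp [dec_of_seq hp h0])
  induction I, p using net.induct D with
  | case1 I =>
    rw [net]
    exact ⟨⟨by simp, by simp, by simp, by simp⟩, by simp [dec]⟩
  | case2 I x =>
    rw [net]
    refine ⟨⟨?_, by simp, ?_, by simp⟩, by simp [dec]⟩
    · rintro s rfl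
      exact .var x
    · rintro s rfl _ μ s' h
      exact absurd h not_step_var
  | case3 I μ p ih =>
    replace hp := wf_par_pre.1 hp
    obtain ⟨ih1, ih2⟩ := ih (.ofSeq hp)
    rw [net]
    refine ⟨ih1.insert (fun C h => .inl h) (wf_seq_pre.2 hp) (fun t ν m => ?_) ?_, by simp [dec]⟩
    · simp only [Set.mem_singleton_iff, Prod.mk.injEq, step_pre]
      constructor
      · rintro ⟨rfl, rfl, rfl⟩
        exact ⟨rfl, p, ⟨rfl, rfl⟩, rfl⟩
      · rintro ⟨rfl, _, ⟨rfl, rfl⟩, rfl⟩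
        exact ⟨rfl, rfl, rfl⟩
    · intro ν s' h h0
      obtain ⟨rfl, rfl⟩ := step_pre.1 h
      exact hself hp ih2 h0
  | case4 I p q ihp ihq =>
    obtain ⟨hp, hq⟩ := wf_par_sum.1 hp
    obtain ⟨p1, p2⟩ := ihp hp.par_of_grd
    obtain ⟨q1, q2⟩ := ihq hq.par_of_grd
    have tp := fun μ m => p1.mem_trans_iff hp (hself hp.seq_of_grd p2) (μ := μ) (m := m)
    have tq := fun μ m => q1.mem_trans_iff hq (hself hq.seq_of_grd q2) (μ := μ) (m := m)
    rw [net, Set.union_assoc, Set.union_assoc]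
    refine ⟨((p1.keep p).union (q1.keep q)).insert (fun C h => .inl h) (wf_seq_sum.2 ⟨hp, hq⟩)
      (fun t ν m => ?_) ?_, by simp [dec]⟩
    · simp only [Set.mem_ofPred_eq, tp, tq, step_sum, or_and_right, exists_or]
    · intro ν s' h h0
      rcases step_sum.1 h with h | h
      · have := (tp ν (post s')).2 ⟨s', h, rfl⟩
        rw [post_of_ne h0] at this
        exact .inl (mem_keep_places p1 this)
      · have := (tq ν (post s')).2 ⟨s', h, rfl⟩
        rw [post_of_ne h0] at this
        exact .inr (mem_keep_places q1 this)
  | case5 I p q ihp ihq =>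
    obtain ⟨hp, hq⟩ := wf_par_par.1 hp
    obtain ⟨p1, p2⟩ := ihp hp
    obtain ⟨q1, q2⟩ := ihq hq
    rw [net]
    refine ⟨p1.union q1, fun s hs => ?_⟩
    rcases Multiset.mem_add.1 hs with h | h
    exacts [.inl (p2 s h), .inr (q2 s h)]
  | case6 I C hC =>
    rw [net]
    simp only [hC, dite_true]
    refine ⟨⟨?_, by simp, ?_, by simp⟩, by simp [dec]⟩
    · rintro s rfl
      exact .con C
    · rintro s rfl h
      exact absurd rfl (h C hC)
  | case7 I C hC hb =>
    rw [net]
    simp only [hC, dite_false, hb]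
    refine ⟨⟨?_, by simp, ?_, by simp⟩, by simp [dec]⟩
    · rintro s rfl
      exact .con C
    · rintro s rfl _ μ s' h
      cases h with | con h _ => simp [hb] at h
  | case8 I C hC s hb ih =>
    have hs := body_grd hb
    obtain ⟨s1, s2⟩ := ih hs.par_of_grd
    have ts := fun μ m => s1.mem_trans_iff hs (hself hs.seq_of_grd s2) (μ := μ) (m := m)
    rw [net]
    simp only [hC, dite_false, hb]
    refine ⟨(s1.keep s).insert ?_ (.con C) (fun t ν m => ?_) ?_, by simp [dec]⟩
    · rintro C' (rfl | h)
      exacts [.inr rfl, .inl h]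
    · simp only [Set.mem_ofPred_eq, ts, step_con hb]
    · intro ν s' h h0
      have := (ts ν (post s')).2 ⟨s', (step_con hb).1 h, rfl⟩
      rw [post_of_ne h0] at this
      exact mem_keep_places s1 this

/-- Equivalence of low-level markings may be checked on the operational semantics, instead of in
the union of the two nets. -/
theorem lowEquiv_of_eqv [Finite K] {p q : Tm H L K} (hp : WF .par p) (hq : WF .par q)
    (h : Eqv D (fun μ => ¬ μ.IsHigh) (· = .tau) p q) : LowEquiv D p q := by
  obtain ⟨p1, p2⟩ := net_represents (D := D) ∅ p hp
  obtain ⟨q1, q2⟩ := net_represents (D := D) ∅ q hq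
  have hN := p1.union q1
  set N := (net D ∅ p).prune.union (net D ∅ q).prune with hNdef
  set T := Tr D (fun μ => ¬ μ.IsHigh)
  have htrans : ∀ s ℓ m, (s, ℓ, m) ∈ N.trans ↔ s ∈ N.places ∧ T s ℓ m := by
    intro s ℓ m
    have : (s, ℓ, m) ∈ N.trans ↔
        (s, ℓ, m) ∈ ((net D ∅ p).union (net D ∅ q)).trans ∧ ¬ ℓ.IsHigh := by
      simp only [hNdef, Net.union, Net.prune, Set.mem_union, Set.mem_ofPred_eq, or_and_right]
    rw [this]
    constructor
    · rintro ⟨h1, h2⟩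
      exact ⟨(hN.sound s ℓ m h1).1, h2, (hN.sound s ℓ m h1).2⟩
    · rintro ⟨h1, h2, s', h3, rfl⟩
      exact ⟨hN.complete s h1 (by simp) ℓ s' h3, h2⟩
  have hclosed : ∀ s ℓ s', s ∈ N.places → T s ℓ (some s') → s' ∈ N.places := by
    rintro s ℓ s' hs ⟨h2, u, h3, h4⟩
    have := hN.complete s hs (by simp) ℓ u h3
    rw [← h4] at this
    exact hN.closed s ℓ s' this
  have hquiet : ∀ s s', s ∈ N.places → Quiet T (· = .tau) s s' →
      N.Silent s (some s') ∧ s' ∈ N.places := by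
    intro s s' hs hq
    induction hq with
    | refl => exact ⟨.refl s, hs⟩
    | tail _ hst ih =>
      obtain ⟨ℓ, rfl, h1⟩ := hst
      exact ⟨.step ih.1 ((htrans _ _ _).2 ⟨ih.2, h1⟩), hclosed _ _ _ ih.2 h1⟩
  let R : Tm H L K → Tm H L K → Prop := fun a b =>
    a ∈ N.places ∧ b ∈ N.places ∧ Bisim T (· = .tau) a b
  have hmatch : ∀ a b, R a b → N.BranchMatch R a b := by
    rintro a b ⟨ha, hb, hab⟩ ℓ m hm
    have hm := ((htrans _ _ _).1 hm).2
    rcases Bisim.isSim _ _ hab ℓ m hm with ⟨h1, a', b', rfl, h2, h3, h4⟩ | ⟨b', m', h1, h2, h3, h4⟩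
    · obtain ⟨h5, h6⟩ := hquiet _ _ hb h2
      exact .inl ⟨h1, a', b', rfl, h5, ⟨ha, h6, h3⟩, ⟨hclosed _ _ _ ha hm, h6, h4⟩⟩
    · obtain ⟨h5, h6⟩ := hquiet _ _ hb h1
      refine .inr ⟨b', m', h5, (htrans _ _ _).2 ⟨h6, h2⟩, ⟨ha, h6, h3⟩, ?_⟩
      rcases h4 with h4 | ⟨a₁, b₁, rfl, rfl, h4⟩
      · exact .inl h4
      · exact .of ⟨hclosed _ _ _ ha hm, hclosed _ _ _ h6 h2, h4⟩
  have hflip : (fun a b => R b a) = R := by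
    funext a b
    exact propext ⟨fun ⟨h1, h2, h3⟩ => ⟨h2, h1, h3.symm⟩, fun ⟨h1, h2, h3⟩ => ⟨h2, h1, h3.symm⟩⟩
  have hR : N.IsBranchingBisim R := by
    intro a b hab
    refine ⟨hab.1, hab.2.1, hmatch a b hab, ?_⟩
    rw [hflip]
    exact hmatch b a ⟨hab.2.1, hab.1, hab.2.2.symm⟩
  have hpost : ∀ a b ℓ m m', a ∈ N.places → b ∈ N.places → T a ℓ m → T b ℓ m' →
      PostRel (Bisim T (· = .tau)) m m' → PostRel N.BranchingBisimilar m m' := by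
    rintro a b ℓ m m' ha hb hm hm' (h | ⟨a', b', rfl, rfl, h⟩)
    · exact .inl h
    · exact .of ⟨R, hR, hclosed _ _ _ ha hm, hclosed _ _ _ hb hm', h⟩
  refine Multiset.Rel.mono h fun a ha b hb hab => ?_
  have ha : a ∈ N.places := .inl (p2 a ha)
  have hb : b ∈ N.places := .inr (q2 b hb)
  refine ⟨ha, hb, fun ℓ => ⟨fun m hm => ?_, fun m hm => ?_⟩⟩
  · have hm := ((htrans _ _ _).1 hm).2
    obtain ⟨m', h1, h2⟩ := hab.1 ℓ m hm
    exact ⟨m', (htrans _ _ _).2 ⟨hb, h1⟩, hpost _ _ _ _ _ ha hb hm h1 h2⟩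
  · have hm := ((htrans _ _ _).1 hm).2
    obtain ⟨m', h1, h2⟩ := hab.2 ℓ m hm
    refine ⟨m', (htrans _ _ _).2 ⟨ha, h1⟩, hpost _ _ _ _ _ ha hb h1 hm ?_⟩
    exact h2.flip.mono fun _ _ h => h.symm

end NetSemantics

/-! ### Well-typed processes -/

section Types

variable {H L K : Type*} {D : Env H L K}

/-- Equivalence of the markings of two terms when the high-level transitions are pruned. -/
abbrev LowEqv (D : Env H L K) (p q : Tm H L K) : Prop :=
  Eqv D (fun μ => ¬ μ.IsHigh) (· = .tau) p q

/-- The transitions that strong bisimilarity compares: all of them, with no action absorbed. -/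
abbrev Strong (D : Env H L K) : Tm H L K → Tm H L K → Prop :=
  Bisim (Tr D fun _ => True) fun _ => False

/-- With the high-level transitions pruned, `r` does not change the behaviour of a term. -/
theorem lowEqv_restr {p : Tm H L K} (hp : WF .seq p) : LowEqv D p p.restr := by
  let S : Tm H L K → Tm H L K → Prop := fun s t => WF .seq s ∧ t = s.restr
  have hnil : ∀ s : Tm H L K, s = .nil ↔ s.restr = .nil := fun s => restr_eq_nil.symm
  have h1 : ∀ s t, S s t → Root (Tr D fun μ => ¬ μ.IsHigh) S s t := by
    rintro s _ ⟨hs, rfl⟩ ℓ _ ⟨hℓ, s', h, rfl⟩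
    exact ⟨_, ⟨hℓ, _, h.restr hℓ, rfl⟩, postRel_post (hnil s') fun _ _ => ⟨h.wf_seq hs, rfl⟩⟩
  have h2 : ∀ s t, S s t → Root (Tr D fun μ => ¬ μ.IsHigh) (flip S) t s := by
    rintro s _ ⟨hs, rfl⟩ ℓ _ ⟨hℓ, z, h, rfl⟩
    obtain ⟨-, s', h', rfl⟩ := step_restr h
    exact ⟨_, ⟨hℓ, _, h', rfl⟩,
      postRel_post (hnil s').symm fun _ _ => ⟨h'.wf_seq hs, rfl⟩⟩
  have hbis : ∀ s t, S s t → Bisim (Tr D fun μ => ¬ μ.IsHigh) (· = .tau) s t := fun s t h =>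
    ⟨S, fun a b hab => (h1 a b hab).sim hab, fun a b hab => (h2 b a hab).sim hab, h⟩
  exact (eqv_seq hp hp.restr).2 ⟨hnil p, (h1 _ _ ⟨hp, rfl⟩).mono hbis,
    (h2 _ _ ⟨hp, rfl⟩).mono fun a b h => (hbis b a h).symm⟩

theorem Strong.root {s t : Tm H L K} (h : Strong D s t) :
    Root (Tr D fun _ => True) (Strong D) s t := by
  intro ℓ m hm
  rcases Bisim.isSim _ _ h ℓ m hm with ⟨h, -⟩ | ⟨t', m', h1, h2, -, h4⟩
  · exact h.elim
  · obtain rfl : t = t' := by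
      rcases h1.cases_head with h | ⟨_, ⟨_, h, _⟩, _⟩
      exacts [h, h.elim]
    exact ⟨m', h2, h4⟩

theorem Strong.rbisim_low {s t : Tm H L K} (h : Strong D s t) :
    RBisim (Tr D fun μ => ¬ μ.IsHigh) (· = .tau) s t := by
  have h1 : ∀ s t, Strong D s t → Root (Tr D fun μ => ¬ μ.IsHigh) (Strong D) s t := by
    intro s t h ℓ m hm
    obtain ⟨m', h1, h2⟩ := h.root ℓ m ⟨trivial, hm.2⟩
    exact ⟨m', ⟨hm.1, h1.2⟩, h2⟩
  have h2 : ∀ s t, Strong D s t → Bisim (Tr D fun μ => ¬ μ.IsHigh) (· = .tau) s t := fun s t h =>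
    ⟨Strong D, fun a b hab => (h1 a b hab).sim hab,
      fun a b hab => ((h1 a b hab.symm).mono fun _ _ h => h.symm).sim hab, h⟩
  exact ⟨(h1 s t h).mono h2, (h1 t s h.symm).mono h2⟩

/-- Security up to a depth: all states reachable in less than `n` steps are
equivalent, on the low level, to the states that their high-level moves lead to. -/
def SafeUpto (D : Env H L K) : ℕ → Tm H L K → Prop
  | 0, _ => True
  | n + 1, p => (∀ h p', Step D p (.high h) p' → LowEqv D p p') ∧
      ∀ μ p', Step D p μ p' → SafeUpto D n p'

theorem SafeUpto.pred {n : ℕ} {p : Tm H L K} (h : SafeUpto D (n + 1) p) : SafeUpto D n p := by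
  induction n generalizing p with
  | zero => trivial
  | succ n ih => exact ⟨h.1, fun μ p' hs => ih (h.2 μ p' hs)⟩

theorem SafeUpto.of_not_step {p : Tm H L K} (h : ∀ μ p', ¬ Step D p μ p') (n : ℕ) :
    SafeUpto D n p := by
  cases n with
  | zero => trivial
  | succ n => exact ⟨fun _ _ hs => absurd hs (h _ _), fun _ _ hs => absurd hs (h _ _)⟩

theorem SafeUpto.par {n : ℕ} {p q : Tm H L K} (hp : SafeUpto D n p) (hq : SafeUpto D n q) :
    SafeUpto D n (.par p q) := by
  induction n generalizing p q with
  | zero => trivial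
  | succ n ih =>
    refine ⟨fun h z hs => ?_, fun μ z hs => ?_⟩
    · cases hs with
      | parL hs => exact (hp.1 h _ hs).par (.refl q)
      | parR hs => exact Eqv.par (.refl p) (hq.1 h _ hs)
    · cases hs with
      | parL hs => exact ih (hp.2 μ _ hs) hq.pred
      | parR hs => exact ih hp.pred (hq.2 μ _ hs)

/-- Security is invariant under strong bisimilarity. Invariance under branching bisimilarity would
not do, as it does not preserve rooted equivalence. -/
theorem SafeUpto.of_strong {n : ℕ} {s t : Tm H L K} (hs : WF .seq s) (ht : WF .seq t)
    (hst : Strong D s t) (h : SafeUpto D n t) : SafeUpto D n s := by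
  induction n generalizing s t with
  | zero => trivial
  | succ n ih =>
    have key : ∀ μ s', Step D s μ s' → ∃ t', Step D t μ t' ∧ (s' = .nil ∧ t' = .nil ∨
        s' ≠ .nil ∧ t' ≠ .nil ∧ Strong D s' t') := by
      intro μ s' h1
      obtain ⟨m, ⟨-, t', h2, rfl⟩, h3⟩ := hst.root μ _ ⟨trivial, s', h1, rfl⟩
      exact ⟨t', h2, of_postRel_post h3⟩
    refine ⟨fun a s' h1 => ?_, fun μ s' h1 => ?_⟩
    · obtain ⟨t', h2, h3⟩ := key _ s' h1
      have hs0 : s ≠ .nil := by rintro rfl; exact not_step_nil h1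
      have ht0 : t ≠ .nil := by rintro rfl; exact not_step_nil h2
      have h4 : LowEqv D s t := (eqv_seq hs ht).2 ⟨by simp [hs0, ht0], hst.rbisim_low⟩
      have h5 : LowEqv D t' s' := by
        refine (eqv_seq (h2.wf_seq ht) (h1.wf_seq hs)).2 ?_
        rcases h3 with ⟨rfl, rfl⟩ | ⟨h3, h3', h3''⟩
        exacts [⟨.rfl, .refl _⟩, ⟨by simp [h3, h3'], Strong.rbisim_low (Bisim.symm h3'')⟩]
      exact (h4.trans (h.1 a t' h2)).trans h5
    · obtain ⟨t', h2, ⟨rfl, rfl⟩ | ⟨-, -, h3⟩⟩ := key μ s' h1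
      · exact .of_not_step (fun _ _ => not_step_nil) n
      · exact ih (h1.wf_seq hs) (h2.wf_seq ht) h3 (h.2 μ t' h2)

theorem SafeUpto.con {n : ℕ} {C : Const K} {s : Tm H L K} (hb : D.body C = some s)
    (h : SafeUpto D n s) : SafeUpto D n (.con C) := by
  cases n with
  | zero => trivial
  | succ n =>
    refine ⟨fun a p' hs => ?_, fun μ p' hs => h.2 μ p' ((step_con hb).1 hs)⟩
    have hs := (step_con hb).1 hs
    have h0 : s ≠ .nil := by rintro rfl; exact not_step_nil hs
    exact (eqv_of_tr_iff (.con C) (body_grd hb).seq_of_grd (by simp) h0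
      fun _ _ => tr_con hb).trans (h.1 a p' hs)

/-- A term typed under the assumptions `I` is as safe as the constants in `I`, and even one step
safer if it is guarded, because a constant can then be reached only by a move. It is this one step
that makes the assumption on a constant usable in the typing of its own body. -/
theorem Typing.safeUpto {p : Tm H L K} {I : Set (Const K)} (ht : Typing D p I) :
    WF .par p → ∀ n, (∀ C ∈ I, SafeUpto D n (.con C)) →
      SafeUpto D n p ∧ (WF .grd p → SafeUpto D (n + 1) p) := by
  have both : ∀ {n : ℕ} {p : Tm H L K}, SafeUpto D (n + 1) p →
      SafeUpto D n p ∧ (WF .grd p → SafeUpto D (n + 1) p) := fun h => ⟨h.pred, fun _ => h⟩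
  induction ht with
  | nil => exact fun _ n _ => both (.of_not_step (fun _ _ => not_step_nil) _)
  | sumLow hp hq _ _ hlow ihp ihq =>
    intro _ n hI
    have h1 := (ihp hp.par_of_grd n hI).2 hp
    have h2 := (ihq hq.par_of_grd n hI).2 hq
    refine both ⟨fun a p' hs => ?_, fun μ p' hs => ?_⟩
    · exact absurd trivial (hlow (.high a) (init_iff.2 ⟨p', hs⟩))
    · exact (step_sum.1 hs).elim (h1.2 μ p') (h2.2 μ p')
  | par hp hq _ _ ihp ihq =>
    intro _ n hI
    exact ⟨(ihp hp n hI).1.par (ihq hq n hI).1, fun h => absurd h not_wf_grd_par⟩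
  | @sumHigh a p q I hp hq _ h0 _ hr ihp ihq =>
    intro _ n hI
    have h1 := (ihp (.ofSeq hp) n hI).1
    have h2 := (ihq hq.par_of_grd n hI).2 hq
    have h3 : LowEqv D p.restr q.restr := hr.eqv (.inr ⟨rfl, id⟩)
    have hq0 : q ≠ .nil := by
      intro h
      have := ((eqv_seq hp.restr hq.seq_of_grd.restr).1 h3).1.2 (restr_eq_nil.2 h)
      exact h0 (restr_eq_nil.1 this)
    have h4 : LowEqv D (.sum (.pre (.high a) p) q) q := by
      refine eqv_of_tr_iff (wf_seq_sum.2 ⟨.pre hp, hq⟩) hq.seq_of_grd (by simp) hq0 fun ℓ m => ?_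
      rw [tr_sum, tr_pre]
      refine or_iff_right ?_
      rintro ⟨h, rfl, -⟩
      exact h trivial
    refine both ⟨fun b p' hs => ?_, fun μ p' hs => ?_⟩
    · rcases step_sum.1 hs with hs | hs
      · obtain ⟨-, rfl⟩ := step_pre.1 hs
        exact ((h4.trans (lowEqv_restr hq.seq_of_grd)).trans h3.symm).trans (lowEqv_restr hp).symm
      · exact h4.trans (h2.1 b p' hs)
    · rcases step_sum.1 hs with hs | hs
      · obtain ⟨-, rfl⟩ := step_pre.1 hs
        exact h1
      · exact h2.2 μ p' hs
  | preLow hp _ hμ ih =>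
    intro _ n hI
    refine both ⟨fun b p' hs => ?_, fun μ p' hs => ?_⟩
    · obtain ⟨rfl, -⟩ := step_pre.1 hs
      exact absurd trivial hμ
    · obtain ⟨-, rfl⟩ := step_pre.1 hs
      exact (ih (.ofSeq hp) n hI).1
  | @preStuck a p I hp hd =>
    intro _ n hI
    have h1 : Eqv D (fun _ => True) (· = .tau) p (.sum .nil .nil) := hd.eqv (.inr ⟨rfl, trivial⟩)
    obtain ⟨h2, h3⟩ := (eqv_seq hp (WF.sum .nil .nil).seq_of_grd).1 h1
    have h0 : p ≠ .nil := fun h => by simpa using h2.1 h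
    have hstuck : ∀ μ p', ¬ Step D p μ p' := by
      intro μ p' hs
      obtain ⟨m, h4, -⟩ := h3.1 μ _ ⟨trivial, p', hs, rfl⟩
      simp [tr_sum, tr_nil] at h4
    refine both ⟨fun b p' hs => ?_, fun μ p' hs => ?_⟩
    · obtain ⟨-, rfl⟩ := step_pre.1 hs
      refine eqv_of_tr_iff (wf_seq_pre.2 hp) hp (by simp) h0 fun ℓ m => iff_of_false ?_ ?_
      · rw [tr_pre]
        rintro ⟨h, rfl, -⟩
        exact h trivial
      · rintro ⟨_, s', hs, -⟩
        exact hstuck ℓ s' hs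
    · obtain ⟨-, rfl⟩ := step_pre.1 hs
      exact .of_not_step hstuck n
  | @preHigh a p I hp hne hhigh _ ih =>
    intro _ n hI
    have h0 : p ≠ .nil := by
      rintro rfl
      obtain ⟨μ, hμ⟩ := hne
      obtain ⟨p', hs⟩ := init_iff.1 hμ
      exact not_step_nil hs
    refine both ⟨fun b p' hs => ?_, fun μ p' hs => ?_⟩
    · obtain ⟨-, rfl⟩ := step_pre.1 hs
      refine eqv_of_tr_iff (wf_seq_pre.2 hp) hp (by simp) h0 fun ℓ m => iff_of_false ?_ ?_
      · rw [tr_pre]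
        rintro ⟨h, rfl, -⟩
        exact h trivial
      · rintro ⟨h, s', hs, -⟩
        exact h (hhigh ℓ (init_iff.2 ⟨s', hs⟩))
    · obtain ⟨-, rfl⟩ := step_pre.1 hs
      exact (ih (.ofSeq hp) n hI).1
  | conMem hC => exact fun _ n hI => ⟨hI _ hC, fun h => absurd h not_wf_grd_con⟩
  | @conBody C p p' I _ hb hd _ ih =>
    intro _ n hI
    refine ⟨?_, fun h => absurd h not_wf_grd_con⟩
    have hp := body_grd hb
    have hp' := hd.grd_of_grd hp
    have hE : Eqv D (fun _ => True) (fun _ => False) p p' := hd.eqv (.inl subset_rfl)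
    have hst : Strong D p p' := ((eqv_seq hp.seq_of_grd hp'.seq_of_grd).1 hE).2.bisim
    -- To reach depth `n + 1` the body needs its constants, `C` included, only up to depth `n`.
    induction n with
    | zero => trivial
    | succ n ihn =>
      have hI' : ∀ C' ∈ insert C I, SafeUpto D n (.con C') := by
        rintro C' (rfl | h)
        exacts [ihn fun C' h => (hI C' h).pred, (hI C' h).pred]
      exact .con hb (.of_strong hp.seq_of_grd hp'.seq_of_grd hst
        ((ih hp'.par_of_grd n hI').2 hp'))

theorem dni_of_safeUpto [Finite K] {p : Tm H L K} (hp : WF .par p) (h : ∀ n, SafeUpto D n p) :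
    DNI D p := by
  intro p' p'' a hreach hs
  have key : WF .par p' ∧ ∀ n, SafeUpto D n p' := by
    clear hs
    induction hreach with
    | refl => exact ⟨hp, h⟩
    | tail _ hst ih =>
      obtain ⟨μ, hμ⟩ := hst
      exact ⟨hμ.wf_par ih.1, fun n => (ih.2 (n + 1)).2 μ _ hμ⟩
  exact lowEquiv_of_eqv key.1 (hs.wf_par key.1) ((key.2 1).1 a p'' hs)

end Types

end CFM

theorem mainTheorem3 {H L K : Type*} [Finite H] [Finite L] [Finite K]
    (D : CFM.Env H L K) (p : CFM.Tm H L K) (hp : CFM.IsCFM D p) (ht : CFM.Typed D p) :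
    CFM.DNI D p :=
  CFM.dni_of_safeUpto hp.wf fun n =>
    (ht.safeUpto hp.wf n fun _ h => h.elim).1
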